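/- **Theorem 1.** Let $\mathcal M_\sigma$ be the set of locally finite subsets of $\mathbb R^d$ (finitely many points in every bounded set), with the $\sigma$-algebra $\mathcal A$ generated by the counting maps $N_A(\phi)=\operatorname{card}(\phi\cap A)$, $A$ bounded Borel. Let $\chi:(\Omega,\mathcal F,\mathbb P)\to(\mathcal M_\sigma,\mathcal A)$ be a point process (a measurable map from a probability space) with law $P$. Assume that $\chi$ is stationary ($P$ is invariant under all translations $\phi\mapsto\phi-t$, $t\in\mathbb R^d$), ergodic (every $F\in\mathcal A$ invariant under all these translations has $P(F)\in\{0,1\}$) and square integrable ($N_A(\chi)\in L^2(\mathbb P)$ for every compact $A$). Let $B\subset\mathbb R^d$ be a Borel set with $0<|B|<\infty$ ($|\cdot|$ is Lebesgue measure), and let $$\widetilde P(F)=\frac1{|B|}\int\sum_{x\in\phi\cap B}1_F(\phi-x)\,dP(\phi),\qquad F\in\mathcal A,$$ be the Palm measure of $\chi$, with intensity $I(\widetilde P)(A)=\int\operatorname{card}(\phi\cap A)\,d\widetilde P(\phi)$ for $A\subset\mathbb R^d$ Borel. For $R>0$ let $B_R$ be the open ball of radius $R$ centred at $0$ and let $$\gamma_R=\frac1{|B_R|}\sum_{x,y\in\chi\cap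 B_R}\delta_{y-x}$$ be the empirical autocorrelation of $\chi$. Then: 1. $I(\widetilde P)$ is locally finite. 2. For every bounded Borel set $C\subset\mathbb R^d$, almost surely $\gamma_R(C)\to I(\widetilde P)(C)$ as $R\to\infty$. 3. Almost surely, $\gamma_R\to I(\widetilde P)$ in the vague topology (that is, $\int f\,d\gamma_R\to\int f\,dI(\widetilde P)$ for all continuous $f:\mathbb R^d\to\mathbb R$ with compact support) as $R\to\infty$; that is, $\chi$ almost surely has the autocorrelation $I(\widetilde P)$. 4. Consequently $\chi$ almost surely has a diffraction measure, which is not random: there is a positive measure $m$ on $\mathbb R^d$ such that almost surely the autocorrelation of $\chi$ is a tempered measure whose Fourier transform, as a tempered distribution, is the tempered measure $m$. -/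

import Mathlib

open Set Filter Topology MeasureTheory ProbabilityTheory
open scoped ENNReal FourierTransform SchwartzMap CompactlySupported

noncomputable section

namespace PointProcess

/-- `ℝ^d` with its Euclidean norm. -/
abbrev Space (d : ℕ) : Type := EuclideanSpace ℝ (Fin d)

/-- The locally finite subsets of `ℝ^d`: those with finitely many points in every bounded set. -/
@[ext]
structure Config (d : ℕ) where
  /-- The underlying set of points. -/
  carrier : Set (Space d)
  finite_inter : ∀ A : Set (Space d), Bornology.IsBounded A → (carrier ∩ A).Finite

variable {d : ℕ}

/-- The number of points of `φ` in `A` (used as a natural number for bounded `A` only). -/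
def N (A : Set (Space d)) (φ : Config d) : ℕ := (φ.carrier ∩ A).ncard

/-- The σ-algebra on configurations generated by the counting variables of the bounded
Borel sets. -/
instance : MeasurableSpace (Config d) :=
  ⨆ (A : Set (Space d)) (_ : Bornology.IsBounded A ∧ MeasurableSet A),
    MeasurableSpace.comap (N A) ⊤

/-- The translate `T_t φ = φ - t = {x - t : x ∈ φ}`. -/
def translate (t : Space d) (φ : Config d) : Config d where
  carrier := (fun x => x - t) '' φ.carrier
  finite_inter := by
    intro A hA
    have hb : Bornology.IsBounded ((fun x => x + t) '' A) := by
      obtain ⟨r, hr⟩ := hA.subset_closedBall 0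
      refine (Metric.isBounded_closedBall (x := (0 : Space d)) (r := r + ‖t‖)).subset ?_
      rintro _ ⟨a, ha, rfl⟩
      have h1 := hr ha
      rw [mem_closedBall_zero_iff] at h1 ⊢
      exact (norm_add_le _ _).trans (by linarith)
    refine ((φ.finite_inter _ hb).image (fun x => x - t)).subset ?_
    rintro _ ⟨⟨x, hx, rfl⟩, hxA⟩
    exact ⟨x, ⟨hx, x - t, hxA, by simp⟩, rfl⟩

/-! ### Measurability of the counting functions and of sums over the points -/

/-- The counting measure `∑_{x ∈ φ} δ_x`. -/
def countMeasure (φ : Config d) : Measure (Space d) :=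
  Measure.sum fun x : φ.carrier => Measure.dirac (x : Space d)

theorem lintegral_countMeasure (φ : Config d) {f : Space d → ℝ≥0∞} (hf : Measurable f) :
    ∫⁻ x, f x ∂(countMeasure φ) = ∑' x : φ.carrier, f x := by
  simp [countMeasure, lintegral_sum_measure, lintegral_dirac' _ hf]

theorem countMeasure_apply (φ : Config d) {A : Set (Space d)} (hA : MeasurableSet A) :
    countMeasure φ A = ((φ.carrier ∩ A).encard : ℝ≥0∞) := by
  rw [← lintegral_indicator_one hA, lintegral_countMeasure φ (measurable_one.indicator hA),
    ← ENNReal.tsum_set_one, tsum_subtype φ.carrier,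
    tsum_subtype (φ.carrier ∩ A) (fun _ => (1 : ℝ≥0∞)), ← Set.indicator_indicator]
  rfl

theorem encard_eq_N (φ : Config d) {A : Set (Space d)} (hA : Bornology.IsBounded A) :
    ((φ.carrier ∩ A).encard : ℝ≥0∞) = (N A φ : ℝ≥0∞) := by
  rw [N, ← (φ.finite_inter A hA).cast_ncard_eq]
  simp

theorem measurable_N {A : Set (Space d)} (hb : Bornology.IsBounded A) (hA : MeasurableSet A) :
    Measurable (N A) := by
  rw [measurable_iff_comap_le]
  exact le_iSup₂_of_le A ⟨hb, hA⟩ le_rfl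

/-- The annulus of the points with `n ≤ ‖x‖ < n + 1`. -/
def annulus (d n : ℕ) : Set (Space d) := (fun x => ⌊‖x‖⌋₊) ⁻¹' {n}

theorem measurableSet_annulus (n : ℕ) : MeasurableSet (annulus d n) :=
  (Nat.measurable_floor.comp measurable_norm) (measurableSet_singleton n)

theorem isBounded_annulus (n : ℕ) : Bornology.IsBounded (annulus d n) := by
  refine (Metric.isBounded_closedBall (x := (0 : Space d)) (r := n + 1)).subset ?_
  intro x hx
  have h : ⌊‖x‖⌋₊ = n := hx
  rw [mem_closedBall_zero_iff, ← h]
  exact (Nat.lt_floor_add_one _).le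

theorem measure_eq_tsum_annulus (μ : Measure (Space d)) {A : Set (Space d)}
    (hA : MeasurableSet A) : μ A = ∑' n, μ (A ∩ annulus d n) := by
  rw [← measure_iUnion]
  · congr 1
    ext x
    simp [annulus]
  · intro m n hmn
    refine Set.disjoint_left.2 ?_
    rintro x ⟨_, hm⟩ ⟨_, hn⟩
    exact hmn (Eq.trans (Eq.symm hm) hn)
  · exact fun n => hA.inter (measurableSet_annulus n)

theorem measurable_countMeasure : Measurable (countMeasure (d := d)) := by
  refine Measure.measurable_of_measurable_coe _ fun A hA => ?_
  simp_rw [measure_eq_tsum_annulus _ hA]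
  refine Measurable.tsum fun n => ?_
  have hb : Bornology.IsBounded (A ∩ annulus d n) :=
    (isBounded_annulus n).subset inter_subset_right
  have hm := hA.inter (measurableSet_annulus (d := d) n)
  simp_rw [countMeasure_apply _ hm, encard_eq_N _ hb]
  exact (measurable_from_top (f := fun k : ℕ => (k : ℝ≥0∞))).comp (measurable_N hb hm)

/-- The counting measures as a kernel from configurations to points. -/
def countKernel (d : ℕ) : Kernel (Config d) (Space d) where
  toFun := countMeasure
  measurable' := measurable_countMeasure

open Classical in
instance : IsSFiniteKernel (countKernel d) := by
  have hs (n k : ℕ) : MeasurableSet {φ : Config d | N (annulus d n) φ = k} :=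
    measurable_N (isBounded_annulus n) (measurableSet_annulus n) (measurableSet_singleton k)
  let η : ℕ → ℕ → Kernel (Config d) (Space d) := fun n k =>
    Kernel.piecewise (hs n k) ((countKernel d).restrict (measurableSet_annulus n)) 0
  have hη (n k : ℕ) : IsFiniteKernel (η n k) := by
    refine ⟨⟨k, by simp, fun φ => ?_⟩⟩
    simp only [η, Kernel.piecewise_apply]
    split_ifs with h
    · rw [Kernel.restrict_apply, Measure.restrict_apply_univ]
      change countMeasure φ _ ≤ _
      rw [countMeasure_apply _ (measurableSet_annulus n), encard_eq_N _ (isBounded_annulus n)]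
      exact le_of_eq (congrArg _ h)
    · simp
  have h : countKernel d = Kernel.sum fun n => Kernel.sum fun k => η n k := by
    ext φ A hA
    rw [Kernel.sum_apply' _ _ hA, measure_eq_tsum_annulus _ hA]
    congr 1
    ext n
    rw [Kernel.sum_apply' _ _ hA, tsum_eq_single (N (annulus d n) φ)]
    · simp [η, Kernel.piecewise_apply, Kernel.restrict_apply, Measure.restrict_apply hA]
    · intro k hk
      have hk' : ¬ N (annulus d n) φ = k := fun e => hk e.symm
      simp [η, Kernel.piecewise_apply, hk']
  rw [h]
  infer_instance

theorem measurable_encard {A : Set (Space d)} (hA : MeasurableSet A) :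
    Measurable fun φ : Config d => ((φ.carrier ∩ A).encard : ℝ≥0∞) := by
  simp_rw [← countMeasure_apply _ hA]
  exact (Measure.measurable_coe hA).comp measurable_countMeasure

theorem N_translate (A : Set (Space d)) (t : Space d) (φ : Config d) :
    (((translate t φ).carrier ∩ A).encard : ℝ≥0∞)
      = ((φ.carrier ∩ (fun x => x - t) ⁻¹' A).encard : ℝ≥0∞) := by
  have h : (translate t φ).carrier ∩ A
      = (fun x => x - t) '' (φ.carrier ∩ (fun x => x - t) ⁻¹' A) :=
    (image_inter_preimage _ _ _).symm
  rw [h, Function.Injective.encard_image (fun a b hab => sub_left_injective hab)]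

theorem measurable_translate_uncurry :
    Measurable fun p : Config d × Space d => translate p.2 p.1 := by
  rw [measurable_iff_comap_le]
  simp only [instMeasurableSpaceConfig, MeasurableSpace.comap_iSup, iSup_le_iff,
    MeasurableSpace.comap_comp]
  rintro A ⟨hb, hA⟩
  rw [← measurable_iff_comap_le]
  have h1 : Measurable fun p : Config d × Space d =>
      (((translate p.2 p.1).carrier ∩ A).encard : ℝ≥0∞) := by
    have h2 : ∀ p : Config d × Space d, (((translate p.2 p.1).carrier ∩ A).encard : ℝ≥0∞)
        = ∫⁻ y, A.indicator 1 (y - p.2) ∂(Kernel.prodMkRight (Space d) (countKernel d) p) := by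
      intro p
      have hm : MeasurableSet ((fun x => x - p.2) ⁻¹' A) := (measurable_sub_const _) hA
      rw [N_translate, ← countMeasure_apply _ hm, ← lintegral_indicator_one hm]
      rfl
    simp_rw [h2]
    refine Measurable.lintegral_kernel_prod_right
      (f := fun (p : Config d × Space d) y => A.indicator (1 : Space d → ℝ≥0∞) (y - p.2)) ?_
    exact (measurable_one.indicator hA).comp
      (measurable_snd.sub (measurable_snd.comp measurable_fst))
  intro s _
  have h3 := h1 ((s.to_countable.image (fun k : ℕ => (k : ℝ≥0∞))).measurableSet)
  convert h3 using 1
  ext p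
  simp only [mem_preimage, Function.comp_apply, encard_eq_N _ hb, mem_image, Nat.cast_inj]
  simp

theorem measurable_tsum_translate {B : Set (Space d)} (hB : MeasurableSet B) {F : Set (Config d)}
    (hF : MeasurableSet F) :
    Measurable fun φ : Config d =>
      ∑' x : ↥(φ.carrier ∩ B), F.indicator (1 : Config d → ℝ≥0∞) (translate (x : Space d) φ) := by
  have hf : Measurable fun p : Config d × Space d =>
      B.indicator (fun x => F.indicator (1 : Config d → ℝ≥0∞) (translate x p.1)) p.2 := by
    have h1 : Measurable fun p : Config d × Space d =>
        F.indicator (1 : Config d → ℝ≥0∞) (translate p.2 p.1) :=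
      (measurable_one.indicator hF).comp measurable_translate_uncurry
    exact h1.indicator (measurable_snd hB)
  have h := Measurable.lintegral_kernel_prod_right' (κ := countKernel d) hf
  convert h using 2 with φ
  refine Eq.trans ?_ (lintegral_countMeasure φ (hf.comp measurable_prodMk_left)).symm
  rw [tsum_subtype (φ.carrier ∩ B)
    (fun x => F.indicator (1 : Config d → ℝ≥0∞) (translate x φ)),
    ← Set.indicator_indicator]
  exact (tsum_subtype φ.carrier _).symm

/-! ### Stationarity, ergodicity, square integrability -/

/-- A law on configurations is stationary if it is invariant under all translations. -/
def Stationary (P : Measure (Config d)) : Prop :=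
  ∀ t : Space d, P.map (translate t) = P

/-- A law on configurations is ergodic if every event invariant under all translations has
probability `0` or `1`. -/
def Ergodic (P : Measure (Config d)) : Prop :=
  ∀ F : Set (Config d), MeasurableSet F → (∀ t : Space d, translate t ⁻¹' F = F) →
    P F = 0 ∨ P F = 1

/-- A point process `χ` is square integrable if the number of its points in every compact set
is square integrable. -/
def SquareIntegrable {Ω : Type*} [MeasurableSpace Ω] (P : Measure Ω) (χ : Ω → Config d) : Prop :=
  ∀ A : Set (Space d), IsCompact A → MemLp (fun ω => (N A (χ ω) : ℝ)) 2 P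

/-! ### Palm measure and intensity -/

/-- The Palm measure of the law `P`, computed with the Borel set `B`:
`P̃(F) = |B|⁻¹ E ∑_{x ∈ φ ∩ B} 1_F(φ - x)`. -/
def palm (P : Measure (Config d)) (B : Set (Space d)) (hB : MeasurableSet B) :
    Measure (Config d) :=
  Measure.ofMeasurable
    (fun F _ => (volume B)⁻¹ *
      ∫⁻ φ, ∑' x : ↥(φ.carrier ∩ B), F.indicator (1 : Config d → ℝ≥0∞) (translate (x : Space d) φ) ∂P)
    (by simp)
    (by
      intro F hF hd
      have h (φ : Config d) :
          ∑' x : ↥(φ.carrier ∩ B),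
            (⋃ i, F i).indicator (1 : Config d → ℝ≥0∞) (translate (x : Space d) φ)
          = ∑' i, ∑' x : ↥(φ.carrier ∩ B),
            (F i).indicator (1 : Config d → ℝ≥0∞) (translate (x : Space d) φ) := by
        rw [ENNReal.tsum_comm]
        congr 1
        ext x
        have e := lintegral_dirac' (translate (x : Space d) φ)
          (f := (⋃ i, F i).indicator 1) (measurable_one.indicator (MeasurableSet.iUnion hF))
        rw [← e, lintegral_indicator_one (MeasurableSet.iUnion hF), measure_iUnion hd hF]
        congr 1
        ext i
        exact Measure.dirac_apply' _ (hF i)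
      simp_rw [h]
      rw [lintegral_tsum fun i => (measurable_tsum_translate hB (hF i)).aemeasurable,
        ENNReal.tsum_mul_left])

theorem palm_apply (P : Measure (Config d)) {B : Set (Space d)} (hB : MeasurableSet B)
    {F : Set (Config d)} (hF : MeasurableSet F) :
    palm P B hB F = (volume B)⁻¹ *
      ∫⁻ φ, ∑' x : ↥(φ.carrier ∩ B),
        F.indicator (1 : Config d → ℝ≥0∞) (translate (x : Space d) φ) ∂P :=
  Measure.ofMeasurable_apply F hF

/-- The intensity `I(m)(A) = ∫ card(φ ∩ A) dm(φ)` of a measure `m` on configurations. -/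
def intensity (m : Measure (Config d)) : Measure (Space d) :=
  Measure.ofMeasurable (fun A _ => ∫⁻ φ, ((φ.carrier ∩ A).encard : ℝ≥0∞) ∂m)
    (by simp)
    (by
      intro A hA hd
      have h (φ : Config d) : ((φ.carrier ∩ ⋃ i, A i).encard : ℝ≥0∞)
          = ∑' i, ((φ.carrier ∩ A i).encard : ℝ≥0∞) := by
        rw [← countMeasure_apply φ (MeasurableSet.iUnion hA), measure_iUnion hd hA]
        simp_rw [countMeasure_apply φ (hA _)]
      simp_rw [h]
      exact lintegral_tsum fun i => (measurable_encard (hA i)).aemeasurable)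

theorem intensity_apply (m : Measure (Config d)) {A : Set (Space d)} (hA : MeasurableSet A) :
    intensity m A = ∫⁻ φ, ((φ.carrier ∩ A).encard : ℝ≥0∞) ∂m :=
  Measure.ofMeasurable_apply A hA

/-! ### Autocorrelation and diffraction -/

/-- The empirical autocorrelation `γ_R = |B_R|⁻¹ ∑_{x, y ∈ φ ∩ B_R} δ_{y - x}`, where `B_R` is
the ball of radius `R` centred at `0`. -/
def empiricalAutocorrelation (φ : Config d) (R : ℝ) : Measure (Space d) :=
  (volume (Metric.ball (0 : Space d) R))⁻¹ •
    Measure.sum fun p : ↥(φ.carrier ∩ Metric.ball 0 R) × ↥(φ.carrier ∩ Metric.ball 0 R) =>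
      Measure.dirac ((p.2 : Space d) - (p.1 : Space d))

/-- `γ` is the autocorrelation of `φ`: it is a locally finite measure and the limit of `γ_R` as
`R → ∞` in the vague topology, that is, against continuous functions with compact support. -/
def IsAutocorrelation (φ : Config d) (γ : Measure (Space d)) : Prop :=
  IsLocallyFiniteMeasure γ ∧
    ∀ f : C_c(Space d, ℝ),
      Tendsto (fun R : ℝ => ∫ x, f x ∂(empiricalAutocorrelation φ R)) atTop (𝓝 (∫ x, f x ∂γ))

/-- `m` is a diffraction measure of `φ`: `φ` has an autocorrelation `γ`, which is tempered, and
the Fourier transform of `γ`, as a tempered distribution, is the positive tempered measure `m`. -/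
def IsDiffractionMeasure (φ : Config d) (m : Measure (Space d)) : Prop :=
  ∃ γ : Measure (Space d), IsAutocorrelation φ γ ∧
    ∃ (_ : γ.HasTemperateGrowth) (_ : m.HasTemperateGrowth),
      𝓕 γ.toTemperedDistribution = m.toTemperedDistribution

end PointProcess

end

/-!
The proof has two halves: an ergodic theorem, which gives the autocorrelation, and a deterministic
argument, which gives the diffraction measure of any configuration that has an autocorrelation.

*Autocorrelation.* For a bounded Borel set `C` write `count C φ` for the number of points of `φ` in
`C`. Up to pairs with a point near the boundary of `B_R`, the number `|B_R| γ_R(C)` is the sum of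
`count C (φ - x)` over the points `x` of `φ` in `B_R`, and this sum is, again up to a boundary
layer, the integral over `t ∈ B_R` of `F (φ - t) / |B_1|`, where `F φ` is the sum of
`count C (φ - x)` over the points `x` of `φ` in the unit ball `B_1`. Square integrability makes `F`
integrable, so the pointwise ergodic theorem for the action of `ℝ^d` by translations
(`IsErgodicFlow.ae_tendsto_laverage`) applies. The mean of `F` is identified through the Campbell
measure `A ↦ E ∑_{x ∈ φ ∩ A} count C (φ - x)`: it is translation invariant, hence a multiple of
Lebesgue measure, and the factor is the intensity of `C` for the Palm measure (`campbell_eq`).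

The ergodic theorem is proved in the classical way. Vitali's covering theorem on `ℝ^d`,
transferred to the probability space by averaging over large balls, gives a maximal inequality
(`IsMeasurePreservingFlow.mul_measure_exists_le_average_le'`). For constants and for coboundaries
`1_A ∘ T_s - 1_A` the averages converge everywhere, and these functions span a dense subspace of
`L²`, because a function orthogonal to all of them is invariant, hence constant, hence zero
(`IsErgodicFlow.dense_convergentSubmodule`).

Vague convergence follows from convergence on a countable family of sets into which every
continuous function with compact support can be approximated (`tendsto_integral_of_tendsto_cell`).

*Diffraction.* For a finite set `F` the measure `∑_{x, y ∈ F} δ_{y - x}` has the Fourier transform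
`|∑_{x ∈ F} e^{2πi⟨x, ξ⟩}|² dξ`, which is positive (`integral_fourier_pairMeasure`). Positive
definiteness bounds the mass of `γ_R` on all unit balls by its mass near the origin
(`volume_mul_pairMeasure_ball_le`), and testing against translates of a bump function bounds the
transforms in the same way (`exists_spectralMeasure_ball_le`). Hence the integrals of
`(1 + ‖x‖) ^ (-(d + 1))` against all these measures stay bounded. Along an ultrafilter the
transforms converge vaguely to some measure `m` (`exists_tendsto_of_weightMass_le`), and the bounds
upgrade both vague limits to convergence against Schwartz functions (`tendsto_integral_of_decay`),
so that `m` is the Fourier transform of the autocorrelation. Since the autocorrelation is almost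
surely the same measure, one typical realisation provides `m` for all of them.
-/

section

open Metric Module TopologicalSpace
open scoped NNReal RealInnerProductSpace

set_option linter.unusedSectionVars false

/-! ### The maximal inequality for actions of a Euclidean space -/

section Flow

variable {E : Type*} [NormedAddCommGroup E] [NormedSpace ℝ E] [FiniteDimensional ℝ E]
  [MeasureSpace E] [BorelSpace E] [(volume : Measure E).IsAddHaarMeasure]
  {X : Type*} [MeasurableSpace X]

theorem tendsto_volume_ball_add_div (c : ℝ) :
    Tendsto (fun R : ℝ => volume (ball (0 : E) (R + c)) / volume (ball (0 : E) R)) atTop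
      (𝓝 1) := by
  have h1 : Tendsto (fun R : ℝ => ENNReal.ofReal (((R + c) / R) ^ finrank ℝ E)) atTop (𝓝 1) := by
    have h2 : Tendsto (fun R : ℝ => 1 + c / R) atTop (𝓝 (1 + 0)) :=
      tendsto_const_nhds.add (tendsto_const_nhds.div_atTop tendsto_id)
    have h3 : Tendsto (fun R : ℝ => (R + c) / R) atTop (𝓝 1) := by
      rw [add_zero] at h2
      refine h2.congr' ?_
      filter_upwards [eventually_gt_atTop 0] with R hR
      field_simp
    simpa using ENNReal.tendsto_ofReal (h3.pow (finrank ℝ E))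
  refine h1.congr' ?_
  filter_upwards [eventually_gt_atTop 0, eventually_gt_atTop (-c)] with R hR hRc
  have hpos : 0 < R + c := by linarith
  have h4 : R + c = (R + c) / R * R := by field_simp
  conv_rhs => rw [h4, Measure.addHaar_ball_mul_of_pos _ _ (div_pos hpos hR)]
  rw [ENNReal.mul_div_cancel_right (measure_ball_pos _ _ hR).ne' measure_ball_lt_top.ne]

/-- The weak type estimate for the averages of `u` over the balls of radius `1, …, L`: a set of
points at which one of these averages is at least `lam` has volume at most `5 ^ dim E` times the
integral of `u` divided by `lam`. -/
theorem mul_volume_le_of_forall_exists_ball (u : E → ℝ≥0∞) (L : ℕ) (K : ℝ) (lam : ℝ≥0∞)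
    (s : Set E) (hs : s ⊆ ball 0 K)
    (h : ∀ t ∈ s, ∃ n : ℕ, 1 ≤ n ∧ n ≤ L ∧
      lam * volume (ball (0 : E) n) ≤ ∫⁻ y in ball t n, u y) :
    lam * volume s ≤ 5 ^ finrank ℝ E * ∫⁻ y in ball (0 : E) (K + L), u y := by
  choose! r h1 hL hr using h
  obtain ⟨v, hvs, hdisj, hcov⟩ := Vitali.exists_disjoint_subfamily_covering_enlargement_ball s
    (fun t => t) (fun t => (r t : ℝ)) L (fun t ht => by exact_mod_cast hL t ht) 5 (by norm_num)
  have hpos : ∀ t ∈ s, (0 : ℝ) < r t := fun t ht => by exact_mod_cast h1 t ht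
  have hcount : v.Countable := hdisj.countable_of_isOpen (fun _ _ => isOpen_ball)
    fun t ht => nonempty_ball.2 (hpos t (hvs ht))
  have hsub : s ⊆ ⋃ b ∈ v, ball b (5 * r b) := fun t ht => by
    obtain ⟨b, hb, hbt⟩ := hcov t ht
    exact mem_biUnion hb (hbt (mem_ball_self (hpos t ht)))
  calc lam * volume s ≤ lam * ∑' b : v, volume (ball (b : E) (5 * r b)) := by
        gcongr
        exact (measure_mono hsub).trans (measure_biUnion_le _ hcount _)
    _ = 5 ^ finrank ℝ E * ∑' b : v, lam * volume (ball (0 : E) (r b)) := by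
        simp_rw [Measure.addHaar_ball_mul_of_pos volume _ (show (0 : ℝ) < 5 by norm_num),
          ENNReal.tsum_mul_left]
        rw [ENNReal.ofReal_pow (by norm_num), mul_left_comm]
        norm_num
    _ ≤ 5 ^ finrank ℝ E * ∑' b : v, ∫⁻ y in ball (b : E) (r b), u y := by
        gcongr with b
        exact hr b (hvs b.2)
    _ = 5 ^ finrank ℝ E * ∫⁻ y in ⋃ b ∈ v, ball b (r b), u y := by
        rw [lintegral_biUnion hcount (fun _ _ => measurableSet_ball) hdisj]
    _ ≤ 5 ^ finrank ℝ E * ∫⁻ y in ball (0 : E) (K + L), u y := by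
        gcongr
        refine iUnion₂_subset fun b hb => ball_subset_ball' ?_
        have h2 := mem_ball.1 (hs (hvs hb))
        have h3 : (r b : ℝ) ≤ L := by exact_mod_cast hL b (hvs hb)
        linarith

/-- A jointly measurable action of the additive group `E` on `X` that preserves `P`. -/
structure IsMeasurePreservingFlow (T : E → X → X) (P : Measure X) : Prop where
  measurable_uncurry : Measurable (Function.uncurry T)
  zero : ∀ x, T 0 x = x
  add : ∀ s t x, T s (T t x) = T (s + t) x
  map_eq : ∀ t, P.map (T t) = P

namespace IsMeasurePreservingFlow

variable {T : E → X → X} {P : Measure X}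

theorem measurable (hT : IsMeasurePreservingFlow T P) (t : E) : Measurable (T t) :=
  hT.measurable_uncurry.comp measurable_prodMk_left

theorem measurePreserving (hT : IsMeasurePreservingFlow T P) (t : E) :
    MeasurePreserving (T t) P P :=
  ⟨hT.measurable t, hT.map_eq t⟩

theorem lintegral_comp (hT : IsMeasurePreservingFlow T P) (t : E) {f : X → ℝ≥0∞}
    (hf : Measurable f) : ∫⁻ x, f (T t x) ∂P = ∫⁻ x, f x ∂P :=
  (hT.measurePreserving t).lintegral_comp hf

theorem lintegral_ball_comp (hT : IsMeasurePreservingFlow T P) (f : X → ℝ≥0∞) (t : E) (r : ℝ)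
    (x : X) : ∫⁻ s in ball (0 : E) r, f (T s (T t x)) = ∫⁻ y in ball t r, f (T y x) := by
  simp_rw [hT.add]
  have h := (measurePreserving_add_right (volume : Measure E) t).setLIntegral_comp_preimage_emb
    (measurableEmbedding_addRight t) (fun y => f (T y x)) (ball t r)
  rw [← h]
  congr 2
  ext s
  simp

theorem measurable_comp_swap (hT : IsMeasurePreservingFlow T P) {f : X → ℝ≥0∞}
    (hf : Measurable f) : Measurable (Function.uncurry fun (x : X) (t : E) => f (T t x)) :=
  hf.comp (hT.measurable_uncurry.comp measurable_swap)

theorem measurable_setLIntegral (hT : IsMeasurePreservingFlow T P) {f : X → ℝ≥0∞}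
    (hf : Measurable f) (A : Set E) : Measurable fun x => ∫⁻ t in A, f (T t x) :=
  Measurable.lintegral_prod_right (hT.measurable_comp_swap hf)

theorem lintegral_setLIntegral [SFinite P] (hT : IsMeasurePreservingFlow T P) {f : X → ℝ≥0∞}
    (hf : Measurable f) (A : Set E) :
    ∫⁻ x, (∫⁻ t in A, f (T t x)) ∂P = volume A * ∫⁻ x, f x ∂P := by
  rw [lintegral_lintegral_swap (hT.measurable_comp_swap hf).aemeasurable]
  simp_rw [hT.lintegral_comp _ hf]
  rw [setLIntegral_const, mul_comm]

theorem measurableSet_average_ge (hT : IsMeasurePreservingFlow T P) {f : X → ℝ≥0∞}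
    (hf : Measurable f) (lam : ℝ≥0∞) (n : ℕ) :
    MeasurableSet {x | lam * volume (ball (0 : E) n) ≤ ∫⁻ t in ball (0 : E) n, f (T t x)} :=
  measurableSet_le measurable_const (hT.measurable_setLIntegral hf _)

/-- The maximal inequality for finitely many radii, transferred from the group to the space on
which it acts by averaging over large balls. -/
theorem mul_measure_exists_le_average_le [SFinite P] (hT : IsMeasurePreservingFlow T P)
    {f : X → ℝ≥0∞} (hf : Measurable f) (lam : ℝ≥0∞) (L : ℕ) :
    lam * P {x | ∃ n : ℕ, 1 ≤ n ∧ n ≤ L ∧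
        lam * volume (ball (0 : E) n) ≤ ∫⁻ t in ball (0 : E) n, f (T t x)}
      ≤ 5 ^ finrank ℝ E * ∫⁻ x, f x ∂P := by
  set D : Set X := {x | ∃ n : ℕ, 1 ≤ n ∧ n ≤ L ∧
    lam * volume (ball (0 : E) n) ≤ ∫⁻ t in ball (0 : E) n, f (T t x)} with hDdef
  have hD : MeasurableSet D := by
    have : D = ⋃ n ∈ Finset.Icc 1 L,
        {x | lam * volume (ball (0 : E) n) ≤ ∫⁻ t in ball (0 : E) n, f (T t x)} := by
      ext x
      simp [hDdef, and_assoc]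
    rw [this]
    exact Finset.measurableSet_biUnion _ fun n _ => hT.measurableSet_average_ge hf lam n
  -- Apply the covering estimate along each orbit, on the ball of radius `k`, and integrate.
  have key (k : ℕ) : lam * P D * volume (ball (0 : E) k)
      ≤ (5 ^ finrank ℝ E * ∫⁻ x, f x ∂P) * volume (ball (0 : E) (k + L)) := by
    have h1 (x : X) : lam * ∫⁻ t in ball (0 : E) k, D.indicator 1 (T t x)
        ≤ 5 ^ finrank ℝ E * ∫⁻ y in ball (0 : E) (k + L), f (T y x) := by
      have hm : Measurable fun t : E => T t x :=
        hT.measurable_uncurry.comp measurable_prodMk_right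
      have h2 : ∫⁻ t in ball (0 : E) k, D.indicator 1 (T t x)
          = volume ((fun t => T t x) ⁻¹' D ∩ ball (0 : E) k) := by
        rw [← Measure.restrict_apply (hm hD), ← lintegral_indicator_one (hm hD)]
        rfl
      rw [h2]
      refine mul_volume_le_of_forall_exists_ball _ L k lam _ inter_subset_right ?_
      rintro t ⟨⟨n, h1, hL, h⟩, -⟩
      exact ⟨n, h1, hL, by rwa [hT.lintegral_ball_comp] at h⟩
    have hind : Measurable (D.indicator (1 : X → ℝ≥0∞)) := measurable_one.indicator hD
    have h3 := lintegral_mono (μ := P) h1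
    rw [lintegral_const_mul _ (hT.measurable_setLIntegral hind _),
      lintegral_const_mul _ (hT.measurable_setLIntegral hf _), hT.lintegral_setLIntegral hind,
      hT.lintegral_setLIntegral hf, lintegral_indicator_one hD] at h3
    calc _ = lam * (volume (ball (0 : E) k) * P D) := by ring
      _ ≤ _ := h3
      _ = _ := by ring
  -- The enlargement of the ball by `L` is negligible as `k → ∞`.
  have hlim : Tendsto (fun k : ℕ => (5 ^ finrank ℝ E * ∫⁻ x, f x ∂P) *
      (volume (ball (0 : E) ((k : ℝ) + L)) / volume (ball (0 : E) (k : ℝ)))) atTop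
      (𝓝 ((5 ^ finrank ℝ E * ∫⁻ x, f x ∂P) * 1)) :=
    ENNReal.Tendsto.const_mul
      ((tendsto_volume_ball_add_div (E := E) L).comp tendsto_natCast_atTop_atTop)
      (Or.inl one_ne_zero)
  rw [mul_one] at hlim
  refine ge_of_tendsto hlim ?_
  filter_upwards [eventually_gt_atTop 0] with k hk
  have hk0 : volume (ball (0 : E) (k : ℝ)) ≠ 0 :=
    (measure_ball_pos _ _ (by exact_mod_cast hk)).ne'
  rw [← mul_div_assoc, ENNReal.le_div_iff_mul_le (Or.inl hk0) (Or.inl measure_ball_lt_top.ne)]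
  exact key k

/-- **Wiener's maximal inequality** for the averages over balls of integral radius. -/
theorem mul_measure_exists_le_average_le' [SFinite P] (hT : IsMeasurePreservingFlow T P)
    {f : X → ℝ≥0∞} (hf : Measurable f) (lam : ℝ≥0∞) :
    lam * P {x | ∃ n : ℕ, 1 ≤ n ∧
        lam * volume (ball (0 : E) n) ≤ ∫⁻ t in ball (0 : E) n, f (T t x)}
      ≤ 5 ^ finrank ℝ E * ∫⁻ x, f x ∂P := by
  have h1 : {x | ∃ n : ℕ, 1 ≤ n ∧
        lam * volume (ball (0 : E) n) ≤ ∫⁻ t in ball (0 : E) n, f (T t x)}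
      = ⋃ L : ℕ, {x | ∃ n : ℕ, 1 ≤ n ∧ n ≤ L ∧
        lam * volume (ball (0 : E) n) ≤ ∫⁻ t in ball (0 : E) n, f (T t x)} := by
    ext x
    simp only [mem_ofPred_eq, mem_iUnion]
    exact ⟨fun ⟨n, h, h'⟩ => ⟨n, n, h, le_rfl, h'⟩, fun ⟨_, n, h, _, h'⟩ => ⟨n, h, h'⟩⟩
  rw [h1, Monotone.measure_iUnion, ENNReal.mul_iSup]
  · exact iSup_le fun L => hT.mul_measure_exists_le_average_le hf lam L
  · rintro L M hLM x ⟨n, h, h', h''⟩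
    exact ⟨n, h, h'.trans hLM, h''⟩

end IsMeasurePreservingFlow

end Flow

/-! ### The pointwise ergodic theorem -/

section ErgodicFlow

variable {E : Type*} [NormedAddCommGroup E] [NormedSpace ℝ E] [FiniteDimensional ℝ E]
  [MeasureSpace E] [BorelSpace E] [(volume : Measure E).IsAddHaarMeasure]
  {X : Type*} [MeasurableSpace X]

/-- A measure preserving flow for which every strictly invariant event is trivial. -/
structure IsErgodicFlow (T : E → X → X) (P : Measure X) : Prop
    extends IsMeasurePreservingFlow T P where
  zero_or_one : ∀ F : Set X, MeasurableSet F → (∀ t, T t ⁻¹' F = F) → P F = 0 ∨ P F = 1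

variable {T : E → X → X} {P : Measure X}

namespace IsErgodicFlow

/-- The zero-one law for events that are invariant only up to null sets: such an event `S` agrees
almost surely with the strictly invariant event that `T t x ∈ S` for almost every `t`. -/
theorem zero_or_one_of_ae [SFinite P] (hT : IsErgodicFlow T P) {S : Set X} (hS : MeasurableSet S)
    (hinv : ∀ t, ∀ᵐ x ∂P, T t x ∈ S ↔ x ∈ S) : P S = 0 ∨ P S = 1 := by
  have hm : MeasurableSet {p : X × E | ¬ T p.2 p.1 ∈ S} :=
    ((hT.measurable_uncurry.comp measurable_swap) hS).compl
  set S' : Set X := {x | ∀ᵐ t : E, T t x ∈ S} with hS'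
  have hS'm : MeasurableSet S' := by
    have h : Measurable fun x : X => volume (Prod.mk x ⁻¹' {p : X × E | ¬ T p.2 p.1 ∈ S}) :=
      measurable_measure_prodMk_left hm
    exact h (measurableSet_singleton 0)
  have hinv' (t : E) : T t ⁻¹' S' = S' := by
    ext x
    simp only [hS', mem_preimage, mem_ofPred_eq, hT.add]
    have h := (measurableEmbedding_addRight t).ae_map_iff (μ := (volume : Measure E))
      (p := fun s => T s x ∈ S)
    rw [(measurePreserving_add_right (volume : Measure E) t).map_eq] at h
    exact h.symm
  have hae : S' =ᵐ[P] S := by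
    -- By Fubini, almost every orbit is almost always on the same side of `S` as its origin.
    have h1 : ∀ᵐ x ∂P, ∀ᵐ t : E, T t x ∈ S ↔ x ∈ S := by
      rw [Measure.ae_ae_comm]
      · exact Eventually.of_forall hinv
      · have h2 : MeasurableSet {p : X × E | T p.2 p.1 ∈ S} :=
          (hT.measurable_uncurry.comp measurable_swap) hS
        have h3 : MeasurableSet {p : X × E | p.1 ∈ S} := measurable_fst hS
        exact h2.iff h3
    filter_upwards [h1] with x hx
    refine propext ⟨fun h => ?_, fun h => ?_⟩
    · have h' : ∀ᵐ t : E, T t x ∈ S := h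
      obtain ⟨t, ht, ht'⟩ := (h'.and hx).exists
      exact ht'.1 ht
    · show ∀ᵐ t : E, T t x ∈ S
      filter_upwards [hx] with t ht using ht.2 h
  rw [← measure_congr hae]
  exact hT.zero_or_one S' hS'm hinv'

theorem ae_eq_const [IsProbabilityMeasure P] (hT : IsErgodicFlow T P) {v : X → ℝ}
    (hv : Measurable v) (hinv : ∀ t, ∀ᵐ x ∂P, v (T t x) = v x) : ∃ c, v =ᵐ[P] fun _ => c := by
  refine exists_eventuallyEq_const_of_forall_separating MeasurableSet fun U hU => ?_
  have h := hT.zero_or_one_of_ae (hv hU) fun t => by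
    filter_upwards [hinv t] with x hx
    simp [hx]
  rcases h with h | h
  · right
    exact measure_eq_zero_iff_ae_notMem.1 h
  · left
    exact (prob_compl_eq_zero_iff (hv hU)).2 h

end IsErgodicFlow

/-- Bounded measurable functions whose averages over balls converge everywhere to their mean. -/
structure HasConvergentAverages (T : E → X → X) (P : Measure X) (G : X → ℝ) : Prop where
  measurable : Measurable G
  bounded : ∃ C, ∀ x, ‖G x‖ ≤ C
  tendsto : ∀ x, Tendsto (fun n : ℕ => ⨍ t in ball (0 : E) n, G (T t x)) atTop (𝓝 (∫ x, G x ∂P))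

namespace HasConvergentAverages

variable {G H : X → ℝ}

theorem integrable [IsFiniteMeasure P] (hG : HasConvergentAverages T P G) : Integrable G P := by
  obtain ⟨C, hC⟩ := hG.bounded
  exact .of_bound hG.measurable.aestronglyMeasurable C (.of_forall hC)

theorem memLp [IsFiniteMeasure P] (hG : HasConvergentAverages T P G) (p : ℝ≥0∞) :
    MemLp G p P := by
  obtain ⟨C, hC⟩ := hG.bounded
  exact .of_bound hG.measurable.aestronglyMeasurable C (.of_forall hC)

theorem integrableOn_orbit (hT : IsMeasurePreservingFlow T P) (hG : HasConvergentAverages T P G)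
    (x : X) (r : ℝ) : IntegrableOn (fun t => G (T t x)) (ball (0 : E) r) := by
  obtain ⟨C, hC⟩ := hG.bounded
  have hm : Measurable fun t : E => T t x := hT.measurable_uncurry.comp measurable_prodMk_right
  exact .of_bound measure_ball_lt_top (hG.measurable.comp hm).aestronglyMeasurable C
    (.of_forall fun t => hC _)

theorem add [IsFiniteMeasure P] (hT : IsMeasurePreservingFlow T P)
    (hG : HasConvergentAverages T P G) (hH : HasConvergentAverages T P H) :
    HasConvergentAverages T P (fun x => G x + H x) where
  measurable := hG.measurable.add hH.measurable
  bounded := by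
    obtain ⟨C, hC⟩ := hG.bounded
    obtain ⟨D, hD⟩ := hH.bounded
    exact ⟨C + D, fun x => (norm_add_le _ _).trans (add_le_add (hC x) (hD x))⟩
  tendsto x := by
    rw [integral_add hG.integrable hH.integrable]
    refine ((hG.tendsto x).add (hH.tendsto x)).congr fun n => ?_
    simp only [setAverage_eq]
    rw [integral_add (hG.integrableOn_orbit hT x n) (hH.integrableOn_orbit hT x n), smul_add]

theorem const_mul (c : ℝ) (hG : HasConvergentAverages T P G) :
    HasConvergentAverages T P (fun x => c * G x) where
  measurable := hG.measurable.const_mul c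
  bounded := by
    obtain ⟨C, hC⟩ := hG.bounded
    refine ⟨‖c‖ * C, fun x => ?_⟩
    rw [norm_mul]
    exact mul_le_mul_of_nonneg_left (hC x) (norm_nonneg c)
  tendsto x := by
    rw [integral_const_mul]
    refine ((hG.tendsto x).const_mul c).congr fun n => ?_
    simp only [setAverage_eq, integral_const_mul, smul_eq_mul]
    ring

theorem const [IsProbabilityMeasure P] (c : ℝ) : HasConvergentAverages T P (fun _ => c) where
  measurable := measurable_const
  bounded := ⟨‖c‖, fun _ => le_rfl⟩
  tendsto x := by
    refine tendsto_const_nhds.congr' ?_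
    filter_upwards [eventually_gt_atTop 0] with n hn
    rw [setAverage_const (measure_ball_pos _ _ (by exact_mod_cast hn)).ne' measure_ball_lt_top.ne]
    simp

/-- Moving the centre of a large ball changes the integral of a function with values in `[0, 1]`
by at most the volume of a boundary layer. -/
theorem setIntegral_ball_le {u : E → ℝ} (hu : Measurable u) (h0 : ∀ t, 0 ≤ u t)
    (h1 : ∀ t, u t ≤ 1) (a b : E) (r : ℝ) :
    ∫ t in ball a r, u t ≤ (∫ t in ball b r, u t) +
      (volume.real (ball b (r + dist a b)) - volume.real (ball b r)) := by
  have hint (A : Set E) (hA : volume A < ∞) : IntegrableOn u A :=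
    .of_bound hA hu.aestronglyMeasurable 1
      (.of_forall fun t => by rw [Real.norm_of_nonneg (h0 t)]; exact h1 t)
  have hsub : ball b r ⊆ ball b (r + dist a b) := 
    ball_subset_ball (by linarith [dist_nonneg (x := a) (y := b)])
  have hsub' : ball a r ⊆ ball b (r + dist a b) := ball_subset_ball' le_rfl
  have h2 : ∫ t in ball a r, u t ≤ ∫ t in ball b (r + dist a b), u t :=
    setIntegral_mono_set (hint _ measure_ball_lt_top) (.of_forall h0) hsub'.eventuallyLE
  have h3 : ∫ t in ball b (r + dist a b), u t
      = (∫ t in ball b r, u t) + ∫ t in ball b (r + dist a b) \ ball b r, u t := by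
    rw [setIntegral_sdiff measurableSet_ball (hint _ measure_ball_lt_top) hsub]
    ring
  have h4 : ∫ t in ball b (r + dist a b) \ ball b r, u t
      ≤ volume.real (ball b (r + dist a b) \ ball b r) := by
    have hfin : volume (ball b (r + dist a b) \ ball b r) < ∞ :=
      (measure_mono sdiff_subset).trans_lt measure_ball_lt_top
    have h5 := setIntegral_mono_on (hint _ hfin)
      (integrableOn_const (C := (1 : ℝ)) hfin.ne)
      (measurableSet_ball.diff measurableSet_ball) (fun t _ => h1 t)
    simpa using h5
  rw [measureReal_sdiff hsub measurableSet_ball measure_ball_lt_top.ne] at h4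
  linarith

theorem coboundary [IsProbabilityMeasure P] (hT : IsMeasurePreservingFlow T P) {A : Set X}
    (hA : MeasurableSet A) (s : E) :
    HasConvergentAverages T P (fun x => A.indicator 1 (T s x) - A.indicator (1 : X → ℝ) x) where
  measurable := ((measurable_one.indicator hA).comp (hT.measurable s)).sub
    (measurable_one.indicator hA)
  bounded := by
    refine ⟨1, fun x => ?_⟩
    by_cases h1 : T s x ∈ A <;> by_cases h2 : x ∈ A <;> simp [h1, h2]
  tendsto x := by
    have hind : Measurable (A.indicator (1 : X → ℝ)) := measurable_one.indicator hA
    have h0 (y : X) : 0 ≤ A.indicator (1 : X → ℝ) y := indicator_nonneg (by simp) y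
    have h1 (y : X) : A.indicator (1 : X → ℝ) y ≤ 1 := indicator_le_self' (by simp) y
    have hintP : Integrable (A.indicator (1 : X → ℝ)) P := (integrable_const (1 : ℝ)).indicator hA
    have hz : ∫ x, (A.indicator 1 (T s x) - A.indicator (1 : X → ℝ) x) ∂P = 0 := by
      have hcomp : Integrable (fun x => A.indicator (1 : X → ℝ) (T s x)) P :=
        (hT.measurePreserving s).integrable_comp_of_integrable hintP
      rw [integral_sub hcomp hintP,
        ← integral_map (hT.measurable s).aemeasurable (by
          rw [hT.map_eq]; exact hind.aestronglyMeasurable), hT.map_eq, sub_self]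
    rw [hz]
    have hm : Measurable fun t : E => T t x := hT.measurable_uncurry.comp measurable_prodMk_right
    set u : E → ℝ := fun t => A.indicator (1 : X → ℝ) (T t x) with hu
    have hum : Measurable u := hind.comp hm
    have hint (a : E) (r : ℝ) : IntegrableOn u (ball a r) :=
      .of_bound measure_ball_lt_top hum.aestronglyMeasurable 1
        (.of_forall fun t => by rw [Real.norm_of_nonneg (h0 _)]; exact h1 _)
    have hvol (a : E) (r : ℝ) : volume.real (ball a r) = volume.real (ball (0 : E) r) := by
      simp only [Measure.real, Measure.addHaar_ball_center]
    have heq (n : ℕ) : ∫ t in ball (0 : E) n, (A.indicator 1 (T s (T t x))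
        - A.indicator (1 : X → ℝ) (T t x)) = (∫ t in ball s n, u t) - ∫ t in ball 0 n, u t := by
      have h2 := (measurePreserving_add_left (volume : Measure E) s).setIntegral_preimage_emb
        (measurableEmbedding_addLeft s) u (ball s n)
      have h3 : (fun x => s + x) ⁻¹' ball s n = ball (0 : E) n := by
        ext t; simp
      rw [h3] at h2
      rw [← h2]
      simp only [hT.add, hu]
      refine integral_sub ?_ (hint 0 n)
      exact IntegrableOn.of_bound measure_ball_lt_top
        (hum.comp (measurable_const_add s)).aestronglyMeasurable 1
        (.of_forall fun t => by rw [Real.norm_of_nonneg (h0 _)]; exact h1 _)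
    have hbound (n : ℕ) : ‖∫ t in ball (0 : E) n, (A.indicator 1 (T s (T t x))
        - A.indicator (1 : X → ℝ) (T t x))‖
        ≤ volume.real (ball (0 : E) (n + ‖s‖)) - volume.real (ball (0 : E) n) := by
      rw [heq, Real.norm_eq_abs, abs_sub_le_iff]
      have h2 := setIntegral_ball_le hum (fun t => h0 _) (fun t => h1 _) s 0 n
      have h3 := setIntegral_ball_le hum (fun t => h0 _) (fun t => h1 _) 0 s n
      rw [hvol s, hvol s, dist_zero_left] at h3
      rw [dist_zero_right] at h2
      constructor <;> linarith
    have hlim : Tendsto (fun n : ℕ => (volume (ball (0 : E) ((n : ℝ) + ‖s‖))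
        / volume (ball (0 : E) (n : ℝ))).toReal - 1) atTop (𝓝 0) := by
      have h2 := ((ENNReal.tendsto_toReal ENNReal.one_ne_top).comp
        ((tendsto_volume_ball_add_div (E := E) ‖s‖).comp tendsto_natCast_atTop_atTop)).sub_const 1
      simpa using h2
    refine squeeze_zero_norm' ?_ hlim
    filter_upwards [eventually_gt_atTop 0] with n hn
    have hpos : 0 < volume.real (ball (0 : E) n) :=
      ENNReal.toReal_pos (measure_ball_pos _ _ (by exact_mod_cast hn)).ne' measure_ball_lt_top.ne
    rw [setAverage_eq, norm_smul, ENNReal.toReal_div, Real.norm_of_nonneg (by positivity)]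
    have h2 := mul_le_mul_of_nonneg_left (hbound n) (inv_nonneg.2 hpos.le)
    refine h2.trans (le_of_eq ?_)
    change _ = volume.real _ / volume.real _ - 1
    field_simp

end HasConvergentAverages

namespace IsErgodicFlow

variable [IsProbabilityMeasure P]

variable (P) in
/-- The classes in `L²(P)` of the functions whose averages over balls converge everywhere. -/
def convergentSubmodule (hT : IsErgodicFlow T P) : Submodule ℝ (Lp ℝ 2 P) where
  carrier := {g | ∃ G, HasConvergentAverages T P G ∧ g =ᵐ[P] G}
  zero_mem' := ⟨fun _ => 0, .const 0, Lp.coeFn_zero _ _ _⟩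
  add_mem' := by
    rintro g h ⟨G, hG, hgG⟩ ⟨H, hH, hhH⟩
    exact ⟨_, hG.add hT.toIsMeasurePreservingFlow hH, (Lp.coeFn_add g h).trans (hgG.add hhH)⟩
  smul_mem' := by
    rintro c g ⟨G, hG, hgG⟩
    refine ⟨_, hG.const_mul c, (Lp.coeFn_smul c g).trans ?_⟩
    filter_upwards [hgG] with x hx
    simp [hx]

/-- A square integrable function orthogonal to the constants and to all the coboundaries
`1_A ∘ T s - 1_A` is invariant, hence constant, hence zero. -/
theorem dense_convergentSubmodule (hT : IsErgodicFlow T P) :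
    (convergentSubmodule P hT).topologicalClosure = ⊤ := by
  rw [Submodule.topologicalClosure_eq_top_iff, Submodule.eq_bot_iff]
  intro v hv
  have horth {G : X → ℝ} (hG : HasConvergentAverages T P G) : ∫ x, G x * v x ∂P = 0 := by
    have h1 := (Submodule.mem_orthogonal _ _).1 hv ((hG.memLp 2).toLp G)
      ⟨G, hG, (hG.memLp 2).coeFn_toLp⟩
    rw [L2.inner_def] at h1
    rw [← h1]
    refine integral_congr_ae ?_
    filter_upwards [(hG.memLp 2).coeFn_toLp] with x hx
    simp [hx, mul_comm]
  have hvi : Integrable v P := (Lp.memLp v).integrable (by norm_num)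
  have hvm : Measurable v := (Lp.stronglyMeasurable v).measurable
  have hinv (t : E) : ∀ᵐ x ∂P, v (T t x) = v x := by
    have hvt : Integrable (fun x => v (T t x)) P :=
      (hT.measurePreserving t).integrable_comp_of_integrable hvi
    refine hvt.ae_eq_of_forall_setIntegral_eq _ _ hvi fun A hA _ => ?_
    -- Orthogonality to the coboundary in the direction `-t`, moved onto `v` by invariance of `P`,
    -- says that `v ∘ T t` and `v` have the same integral over `A`.
    have h1 := horth (.coboundary hT.toIsMeasurePreservingFlow hA (-t))
    have hint : Integrable (fun x => A.indicator (1 : X → ℝ) x * v x) P := by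
      have := hvi.indicator hA
      refine this.congr (.of_forall fun x => ?_)
      by_cases hx : x ∈ A <;> simp [hx]
    have hcomp : (fun x => A.indicator (1 : X → ℝ) (T (-t) x) * v x) ∘ T t
        = fun x => A.indicator (1 : X → ℝ) x * v (T t x) := by
      ext x
      simp [hT.add, hT.zero]
    have hint' : Integrable (fun x => A.indicator (1 : X → ℝ) (T (-t) x) * v x) P := by
      refine hvi.bdd_mul (c := 1) ((measurable_one.indicator hA).comp
        (hT.measurable (-t))).aestronglyMeasurable (.of_forall fun x => ?_)
      by_cases hx : T (-t) x ∈ A <;> simp [hx]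
    have h2 : ∫ x, A.indicator (1 : X → ℝ) (T (-t) x) * v x ∂P
        = ∫ x, A.indicator (1 : X → ℝ) x * v (T t x) ∂P := by
      have h3 := integral_map (μ := P) (hT.measurable t).aemeasurable
        (f := fun x => A.indicator (1 : X → ℝ) (T (-t) x) * v x)
        (by rw [hT.map_eq]; exact hint'.aestronglyMeasurable)
      rw [hT.map_eq] at h3
      rw [h3]
      exact congrArg (fun g : X → ℝ => ∫ x, g x ∂P) hcomp
    simp_rw [sub_mul] at h1
    rw [integral_sub hint' hint, h2, sub_eq_zero] at h1
    have h4 (w : X → ℝ) : ∫ x, A.indicator (1 : X → ℝ) x * w x ∂P = ∫ x in A, w x ∂P := by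
      rw [← integral_indicator hA]
      congr 1
      ext x
      by_cases hx : x ∈ A <;> simp [hx]
    rwa [h4, h4] at h1
  obtain ⟨c, hc⟩ := hT.ae_eq_const hvm hinv
  have h0 := horth (.const 1)
  simp only [one_mul] at h0
  rw [integral_congr_ae hc] at h0
  simp only [integral_const, probReal_univ, one_smul] at h0
  rw [Lp.eq_zero_iff_ae_eq_zero]
  rw [h0] at hc
  exact hc

theorem exists_hasConvergentAverages_near (hT : IsErgodicFlow T P) {f : X → ℝ}
    (hf : Integrable f P) {ε : ℝ≥0∞} (hε : ε ≠ 0) :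
    ∃ G, HasConvergentAverages T P G ∧ ∫⁻ x, ‖f x - G x‖ₑ ∂P < ε := by
  have hε2 : ε / 2 ≠ 0 := (ENNReal.half_pos hε).ne'
  obtain ⟨S, hS, hSm⟩ := (memLp_one_iff_integrable.2 hf).exists_simpleFunc_eLpNorm_sub_lt
    ENNReal.one_ne_top hε2
  have hS2 : MemLp S 2 P := S.memLp_of_isFiniteMeasure 2 P
  have hmem : hS2.toLp S ∈ (convergentSubmodule P hT).topologicalClosure := by
    rw [hT.dense_convergentSubmodule]; trivial
  obtain ⟨g, ⟨G, hG, hgG⟩, hg⟩ := EMetric.mem_closure_iff.1 hmem (ε / 2) (ENNReal.half_pos hε)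
  refine ⟨G, hG, ?_⟩
  have h1 : eLpNorm (⇑S - G) 1 P < ε / 2 := by
    refine lt_of_le_of_lt ?_ hg
    rw [Lp.edist_def]
    refine (eLpNorm_le_eLpNorm_of_exponent_le (p := 1) (q := 2) (by norm_num) ?_).trans
      (le_of_eq (eLpNorm_congr_ae ?_))
    · exact S.measurable.aestronglyMeasurable.sub hG.measurable.aestronglyMeasurable
    · exact (hS2.coeFn_toLp.symm.sub hgG.symm)
  rw [← eLpNorm_one_eq_lintegral_enorm (f := fun x => f x - G x)]
  have h2 : (fun x => f x - G x) = (f - ⇑S) + (⇑S - G) := by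
    ext x; simp
  rw [h2]
  refine (eLpNorm_add_le (hf.aestronglyMeasurable.sub S.measurable.aestronglyMeasurable)
    (S.measurable.aestronglyMeasurable.sub hG.measurable.aestronglyMeasurable) le_rfl).trans_lt ?_
  calc _ < ε / 2 + ε / 2 := ENNReal.add_lt_add hS h1
    _ = ε := ENNReal.add_halves ε

end IsErgodicFlow

end ErgodicFlow

section PointwiseErgodic

variable {E : Type*} [NormedAddCommGroup E] [NormedSpace ℝ E] [FiniteDimensional ℝ E]
  [MeasureSpace E] [BorelSpace E] [(volume : Measure E).IsAddHaarMeasure]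
  {X : Type*} [MeasurableSpace X] {T : E → X → X} {P : Measure X}

namespace IsErgodicFlow

variable [IsProbabilityMeasure P]

/-- Away from the exceptional set of the maximal inequality for `f - G`, the averages of `f`
follow those of `G`. -/
theorem eventually_average_near (hT : IsErgodicFlow T P) {f G : X → ℝ} (hfm : Measurable f)
    (hf : Integrable f P) (hG : HasConvergentAverages T P G) {δ : ℝ} (hδ : 0 < δ)
    (hfG : ∫⁻ x, ‖f x - G x‖ₑ ∂P ≤ ENNReal.ofReal δ) {x : X}
    (hx : ¬ ∃ n : ℕ, 1 ≤ n ∧ ENNReal.ofReal δ * volume (ball (0 : E) n)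
      ≤ ∫⁻ t in ball (0 : E) n, ‖f (T t x) - G (T t x)‖ₑ) :
    ∀ᶠ n : ℕ in atTop, |(⨍ t in ball (0 : E) n, f (T t x)) - ∫ x, f x ∂P| ≤ 3 * δ := by
  have hm : Measurable fun t : E => T t x := hT.measurable_uncurry.comp measurable_prodMk_right
  have hmean : |(∫ x, G x ∂P) - ∫ x, f x ∂P| ≤ δ := by
    rw [← integral_sub hG.integrable hf, ← Real.norm_eq_abs]
    refine (norm_integral_le_lintegral_norm _).trans ?_
    refine ENNReal.toReal_le_of_le_ofReal hδ.le ?_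
    refine le_trans (le_of_eq ?_) hfG
    simp_rw [ofReal_norm, enorm_sub_rev]
  have hGx := (hG.tendsto x).eventually (Metric.closedBall_mem_nhds _ hδ)
  filter_upwards [hGx, eventually_ge_atTop 1] with n hn hn1
  have hlt : ∫⁻ t in ball (0 : E) n, ‖f (T t x) - G (T t x)‖ₑ
      < ENNReal.ofReal δ * volume (ball (0 : E) n) := by
    by_contra h
    exact hx ⟨n, hn1, not_lt.1 h⟩
  have hdi : IntegrableOn (fun t => f (T t x) - G (T t x)) (ball (0 : E) n) :=
    ⟨((hfm.sub hG.measurable).comp hm).aestronglyMeasurable,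
      hlt.trans (ENNReal.mul_lt_top ENNReal.ofReal_lt_top measure_ball_lt_top)⟩
  have hGi := hG.integrableOn_orbit hT.toIsMeasurePreservingFlow x n
  have hpos : 0 < volume.real (ball (0 : E) n) :=
    ENNReal.toReal_pos (measure_ball_pos _ _ (by exact_mod_cast hn1)).ne' measure_ball_lt_top.ne
  have hsplit : (⨍ t in ball (0 : E) n, f (T t x))
      = (⨍ t in ball (0 : E) n, (f (T t x) - G (T t x))) + ⨍ t in ball (0 : E) n, G (T t x) := by
    simp only [setAverage_eq]
    rw [← smul_add, ← integral_add hdi hGi]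
    simp
  have hsmall : |⨍ t in ball (0 : E) n, (f (T t x) - G (T t x))| ≤ δ := by
    rw [setAverage_eq, smul_eq_mul, abs_mul, abs_of_pos (inv_pos.2 hpos), inv_mul_le_iff₀ hpos,
      ← Real.norm_eq_abs]
    refine (norm_integral_le_lintegral_norm _).trans ?_
    simp_rw [ofReal_norm]
    have h2 := ENNReal.toReal_mono
      (ENNReal.mul_ne_top ENNReal.ofReal_ne_top measure_ball_lt_top.ne) hlt.le
    rw [ENNReal.toReal_mul, ENNReal.toReal_ofReal hδ.le] at h2
    rw [mul_comm]
    exact h2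
  rw [Real.dist_eq] at hn
  rw [hsplit]
  rw [abs_le] at *
  constructor <;> linarith [hsmall.1, hsmall.2, hn.1, hn.2, hmean.1, hmean.2]

/-- The pointwise ergodic theorem for real functions and averages over balls of integral
radius. -/
theorem ae_tendsto_average (hT : IsErgodicFlow T P) {f : X → ℝ} (hfm : Measurable f)
    (hf : Integrable f P) :
    ∀ᵐ x ∂P, Tendsto (fun n : ℕ => ⨍ t in ball (0 : E) n, f (T t x)) atTop
      (𝓝 (∫ x, f x ∂P)) := by
  have key (δ : ℝ) (hδ : 0 < δ) : ∀ᵐ x ∂P, ∀ᶠ n : ℕ in atTop,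
      |(⨍ t in ball (0 : E) n, f (T t x)) - ∫ x, f x ∂P| ≤ 3 * δ := by
    rw [ae_iff]
    refine le_antisymm (ENNReal.le_of_forall_pos_le_add fun ε hε _ => ?_) bot_le
    rw [zero_add]
    have hδ' : ENNReal.ofReal δ ≠ 0 := (ENNReal.ofReal_pos.2 hδ).ne'
    have h5 : (5 : ℝ≥0∞) ^ finrank ℝ E ≠ 0 := pow_ne_zero _ (by norm_num)
    have h5' : (5 : ℝ≥0∞) ^ finrank ℝ E ≠ ∞ := ENNReal.pow_ne_top (by norm_num)
    have hε' : (ε : ℝ≥0∞) ≠ 0 := by exact_mod_cast hε.ne'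
    -- The first bound keeps the means of `f` and `G` close, the second makes the exceptional set of
    -- the maximal inequality of measure at most `ε`.
    set κ : ℝ≥0∞ := min (ENNReal.ofReal δ) (ENNReal.ofReal δ * ε / 5 ^ finrank ℝ E) with hκ
    have hκ0 : κ ≠ 0 := (lt_min (pos_iff_ne_zero.2 hδ') (pos_iff_ne_zero.2
      (ENNReal.div_ne_zero.2 ⟨mul_ne_zero hδ' hε', h5'⟩))).ne'
    obtain ⟨G, hG, hfG⟩ := hT.exists_hasConvergentAverages_near hf hκ0
    have hmax := hT.mul_measure_exists_le_average_le' (f := fun x => ‖f x - G x‖ₑ)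
      (hfm.sub hG.measurable).enorm (ENNReal.ofReal δ)
    have hle : ENNReal.ofReal δ * P {x | ∃ n : ℕ, 1 ≤ n ∧ ENNReal.ofReal δ *
        volume (ball (0 : E) n) ≤ ∫⁻ t in ball (0 : E) n, ‖f (T t x) - G (T t x)‖ₑ}
        ≤ ENNReal.ofReal δ * ε := by
      refine hmax.trans ?_
      calc (5 : ℝ≥0∞) ^ finrank ℝ E * ∫⁻ x, ‖f x - G x‖ₑ ∂P
          ≤ 5 ^ finrank ℝ E * (ENNReal.ofReal δ * ε / 5 ^ finrank ℝ E) := by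
            gcongr
            exact hfG.le.trans (min_le_right _ _)
        _ = ENNReal.ofReal δ * ε := ENNReal.mul_div_cancel h5 h5'
    rw [ENNReal.mul_le_mul_iff_right hδ' ENNReal.ofReal_ne_top] at hle
    refine (measure_mono ?_).trans hle
    intro x hx
    by_contra hx'
    exact hx (hT.eventually_average_near hfm hf hG hδ (hfG.le.trans (min_le_left _ _)) hx')
  have hall : ∀ᵐ x ∂P, ∀ k : ℕ, ∀ᶠ n : ℕ in atTop,
      |(⨍ t in ball (0 : E) n, f (T t x)) - ∫ x, f x ∂P| ≤ 3 * (1 / ((k : ℝ) + 1)) :=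
    ae_all_iff.2 fun k => key _ Nat.one_div_pos_of_nat
  filter_upwards [hall] with x hx
  rw [Metric.tendsto_nhds]
  intro ε hε
  obtain ⟨k, hk⟩ := exists_nat_one_div_lt (show 0 < ε / 3 by positivity)
  filter_upwards [hx k] with n hn
  rw [Real.dist_eq]
  linarith

/-- The pointwise ergodic theorem (Wiener): the averages of an integrable function over balls
of integral radius converge almost surely to its mean. -/
theorem ae_tendsto_laverage (hT : IsErgodicFlow T P) {f : X → ℝ≥0∞} (hfm : Measurable f)
    (hfin : ∀ x, f x ≠ ∞) (hf : ∫⁻ x, f x ∂P ≠ ∞) :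
    ∀ᵐ x ∂P, Tendsto
      (fun n : ℕ => (volume (ball (0 : E) n))⁻¹ * ∫⁻ t in ball (0 : E) n, f (T t x)) atTop
      (𝓝 (∫⁻ x, f x ∂P)) := by
  have hloc : ∀ᵐ x ∂P, ∀ n : ℕ, ∫⁻ t in ball (0 : E) n, f (T t x) < ∞ := by
    refine ae_all_iff.2 fun n => ae_lt_top (hT.measurable_setLIntegral hfm _) ?_
    rw [hT.lintegral_setLIntegral hfm]
    exact ENNReal.mul_ne_top measure_ball_lt_top.ne hf
  filter_upwards [hloc, hT.ae_tendsto_average hfm.ennreal_toReal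
    (integrable_toReal_of_lintegral_ne_top hfm.aemeasurable hf)] with x hx hlim
  have hm : Measurable fun t : E => T t x := hT.measurable_uncurry.comp measurable_prodMk_right
  rw [integral_toReal hfm.aemeasurable (.of_forall fun x => (hfin x).lt_top)] at hlim
  have h1 := ENNReal.tendsto_ofReal hlim
  rw [ENNReal.ofReal_toReal hf] at h1
  refine h1.congr' ?_
  filter_upwards [eventually_gt_atTop 0] with n hn
  have hpos : 0 < volume (ball (0 : E) n) := measure_ball_pos _ _ (by exact_mod_cast hn)
  have h2 : ∫ t in ball (0 : E) n, (f (T t x)).toReal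
      = (∫⁻ t in ball (0 : E) n, f (T t x)).toReal :=
    integral_toReal (hfm.comp hm).aemeasurable (.of_forall fun t => (hfin _).lt_top)
  rw [setAverage_eq, h2, smul_eq_mul, Measure.real, ← ENNReal.toReal_inv,
    ← ENNReal.toReal_mul, ENNReal.ofReal_toReal]
  exact ENNReal.mul_ne_top (ENNReal.inv_ne_top.2 hpos.ne') (hx n).ne

end IsErgodicFlow

end PointwiseErgodic

/-! ### Sums over the points of a configuration and the Campbell measure -/

namespace PointProcess

variable {d : ℕ}

instance (φ : Config d) : SFinite (countMeasure φ) :=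
  inferInstanceAs (SFinite (countKernel d φ))

theorem setLIntegral_countMeasure (φ : Config d) {f : Space d → ℝ≥0∞} (hf : Measurable f)
    {A : Set (Space d)} (hA : MeasurableSet A) :
    ∫⁻ x in A, f x ∂(countMeasure φ) = ∑' x : ↥(φ.carrier ∩ A), f x := by
  rw [← lintegral_indicator hA, lintegral_countMeasure φ (hf.indicator hA),
    tsum_subtype (φ.carrier ∩ A) f, ← Set.indicator_indicator]
  exact tsum_subtype φ.carrier _

theorem translate_zero (φ : Config d) : translate 0 φ = φ := by
  ext x
  simp [translate]

theorem translate_translate (s t : Space d) (φ : Config d) :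
    translate s (translate t φ) = translate (s + t) φ := by
  ext x
  simp only [translate, image_image, sub_sub, add_comm s t]

theorem measurable_translate_left (φ : Config d) : Measurable fun x : Space d => translate x φ :=
  measurable_translate_uncurry.comp measurable_prodMk_left

theorem measurable_translate (t : Space d) : Measurable (translate (d := d) t) :=
  measurable_translate_uncurry.comp measurable_prodMk_right

theorem isErgodicFlow_translate {Q : Measure (Config d)} (hstat : Stationary Q)
    (herg : Ergodic Q) : IsErgodicFlow (translate (d := d)) Q where
  measurable_uncurry := measurable_translate_uncurry.comp measurable_swap
  zero := translate_zero
  add := translate_translate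
  map_eq := hstat
  zero_or_one := herg

theorem countMeasure_translate (t : Space d) (φ : Config d) :
    countMeasure (translate t φ) = (countMeasure φ).map (fun x => x - t) := by
  ext A hA
  rw [Measure.map_apply (measurable_sub_const t) hA, countMeasure_apply _ hA, N_translate,
    countMeasure_apply _ (measurable_sub_const t hA)]

/-- The sum of `g (φ - x)` over the points `x` of `φ` in `A`. -/
noncomputable def pointSum (g : Config d → ℝ≥0∞) (A : Set (Space d)) (φ : Config d) : ℝ≥0∞ :=
  ∫⁻ x in A, g (translate x φ) ∂(countMeasure φ)

variable {g : Config d → ℝ≥0∞}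

theorem measurable_comp_translate (hg : Measurable g) (φ : Config d) :
    Measurable fun x : Space d => g (translate x φ) :=
  hg.comp (measurable_translate_left φ)

theorem pointSum_mono {A A' : Set (Space d)} (h : A ⊆ A') (φ : Config d) :
    pointSum g A φ ≤ pointSum g A' φ :=
  lintegral_mono_set h

theorem measurable_pointSum (hg : Measurable g) {A : Set (Space d)} (hA : MeasurableSet A) :
    Measurable (pointSum g A) := by
  have h1 : Measurable fun p : Config d × Space d =>
      A.indicator (fun x => g (translate x p.1)) p.2 :=
    (hg.comp measurable_translate_uncurry).indicator (measurable_snd hA)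
  have h2 := Measurable.lintegral_kernel_prod_right' (κ := countKernel d) h1
  convert h2 using 2 with φ
  exact (lintegral_indicator hA _).symm

theorem pointSum_translate (hg : Measurable g) {A : Set (Space d)} (hA : MeasurableSet A)
    (t : Space d) (φ : Config d) :
    pointSum g A (translate t φ) = pointSum g ((fun x => x - t) ⁻¹' A) φ := by
  rw [pointSum, countMeasure_translate, setLIntegral_map hA
    (measurable_comp_translate hg _) (measurable_sub_const t)]
  simp only [translate_translate, sub_add_cancel, pointSum]

theorem lintegral_palm (Q : Measure (Config d)) [SFinite Q] {B : Set (Space d)}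
    (hB : MeasurableSet B) (hg : Measurable g) :
    ∫⁻ φ, g φ ∂(palm Q B hB) = (volume B)⁻¹ * ∫⁻ φ, pointSum g B φ ∂Q := by
  have hpalm : palm Q B hB = (volume B)⁻¹ • (Q ⊗ₘ ((countKernel d).restrict hB)).map
      (fun p => translate p.2 p.1) := by
    ext F hF
    rw [palm_apply Q hB hF, Measure.smul_apply, Measure.map_apply measurable_translate_uncurry hF,
      Measure.compProd_apply (measurable_translate_uncurry hF), smul_eq_mul]
    congr 2
    ext φ
    rw [← setLIntegral_countMeasure φ
        (measurable_comp_translate (measurable_one.indicator hF) φ) hB,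
      ← lintegral_indicator_one (measurable_prodMk_left (measurable_translate_uncurry hF)),
      Kernel.lintegral_restrict]
    rfl
  have hm : Measurable fun p : Config d × Space d => g (translate p.2 p.1) :=
    hg.comp measurable_translate_uncurry
  rw [hpalm, lintegral_smul_measure, lintegral_map hg measurable_translate_uncurry,
    Measure.lintegral_compProd hm, smul_eq_mul]
  simp_rw [Kernel.lintegral_restrict]
  rfl

/-- The measure `A ↦ E ∑_{x ∈ φ ∩ A} g (φ - x)`. -/
noncomputable def campbell (Q : Measure (Config d)) (g : Config d → ℝ≥0∞) : Measure (Space d) :=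
  ((Q ⊗ₘ countKernel d).withDensity fun p => g (translate p.2 p.1)).map Prod.snd

theorem campbell_apply (Q : Measure (Config d)) [SFinite Q] (hg : Measurable g)
    {A : Set (Space d)} (hA : MeasurableSet A) :
    campbell Q g A = ∫⁻ φ, pointSum g A φ ∂Q := by
  have hm : Measurable fun p : Config d × Space d => g (translate p.2 p.1) :=
    hg.comp measurable_translate_uncurry
  rw [campbell, Measure.map_apply measurable_snd hA, withDensity_apply _ (measurable_snd hA),
    ← lintegral_indicator (measurable_snd hA),
    Measure.lintegral_compProd (hm.indicator (measurable_snd hA))]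
  congr 1
  ext φ
  exact lintegral_indicator hA _

theorem isAddLeftInvariant_campbell {Q : Measure (Config d)} [SFinite Q] (hstat : Stationary Q)
    (hg : Measurable g) : (campbell Q g).IsAddLeftInvariant := by
  refine ⟨fun t => ?_⟩
  ext A hA
  rw [Measure.map_apply (measurable_const_add t) hA,
    campbell_apply Q hg (measurable_const_add t hA), campbell_apply Q hg hA]
  conv_rhs => rw [← hstat (-t)]
  rw [lintegral_map (measurable_pointSum hg hA) (measurable_translate _)]
  simp_rw [pointSum_translate hg hA, sub_neg_eq_add, add_comm t]

/-- By uniqueness of Haar measure, the Campbell measure of a stationary law is proportional to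
Lebesgue measure; the factor is the integral of `g` for the Palm measure. -/
theorem campbell_eq {Q : Measure (Config d)} [SFinite Q] (hstat : Stationary Q)
    (hg : Measurable g) [IsFiniteMeasureOnCompacts (campbell Q g)] {B : Set (Space d)}
    (hB : MeasurableSet B) (hB0 : 0 < volume B) (hBfin : volume B < ∞) (A : Set (Space d)) :
    campbell Q g A = (∫⁻ φ, g φ ∂(palm Q B hB)) * volume A := by
  have := isAddLeftInvariant_campbell hstat hg
  have h := Measure.isAddLeftInvariant_eq_smul (campbell Q g) (volume : Measure (Space d))
  rw [lintegral_palm Q hB hg, ← campbell_apply Q hg hB, h]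
  simp only [Measure.smul_apply, ENNReal.smul_def, smul_eq_mul]
  rw [mul_left_comm, ENNReal.inv_mul_cancel hB0.ne' hBfin.ne, mul_one]

/-! ### Averages of local sums over points -/

/-- Averaging the local sum over translates weights each point `x` of `φ` by the volume of the
set of those `t` in `A` for which `x - t` lies in the unit ball. -/
theorem lintegral_ball_pointSum (hg : Measurable g) (φ : Config d) (A : Set (Space d)) :
    ∫⁻ t in A, pointSum g (ball 0 1) (translate t φ)
      = ∫⁻ x, g (translate x φ) * volume (ball x 1 ∩ A) ∂(countMeasure φ) := by
  have hm : Measurable fun p : Space d × Space d =>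
      (ball (0 : Space d) 1).indicator (fun _ => g (translate p.2 φ)) (p.2 - p.1) :=
    have hs : MeasurableSet {p : Space d × Space d | p.2 - p.1 ∈ ball (0 : Space d) 1} :=
      (measurable_snd.sub measurable_fst) measurableSet_ball
    (hg.comp ((measurable_translate_left φ).comp measurable_snd)).indicator hs
  have h1 (t : Space d) : pointSum g (ball 0 1) (translate t φ)
      = ∫⁻ x, (ball (0 : Space d) 1).indicator (fun _ => g (translate x φ)) (x - t)
        ∂(countMeasure φ) := by
    rw [pointSum_translate hg measurableSet_ball, pointSum,
      ← lintegral_indicator (measurable_sub_const t measurableSet_ball)]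
    rfl
  simp_rw [h1]
  rw [lintegral_lintegral_swap hm.aemeasurable]
  congr 1
  ext x
  have h2 (t : Space d) : (ball (0 : Space d) 1).indicator (fun _ => g (translate x φ)) (x - t)
      = (ball x 1).indicator (fun _ => g (translate x φ)) t := by
    simp only [indicator, mem_ball, dist_comm t x, dist_eq_norm, sub_zero]
  simp_rw [h2]
  rw [lintegral_indicator_const measurableSet_ball, Measure.restrict_apply measurableSet_ball]

/-- Each point of `B_r` contributes fully to the average over `B_s` when `r + 1 ≤ s`. -/
theorem pointSum_mul_volume_le (hg : Measurable g) (φ : Config d) {r s : ℝ} (h : r + 1 ≤ s) :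
    pointSum g (ball 0 r) φ * volume (ball (0 : Space d) 1)
      ≤ ∫⁻ t in ball (0 : Space d) s, pointSum g (ball 0 1) (translate t φ) := by
  rw [lintegral_ball_pointSum hg, pointSum, ← lintegral_mul_const _
    (measurable_comp_translate hg φ), ← lintegral_indicator measurableSet_ball]
  refine lintegral_mono fun x => ?_
  by_cases hx : x ∈ ball (0 : Space d) r
  · have hsub : ball x 1 ⊆ ball (0 : Space d) s :=
      ball_subset_ball' (by linarith [mem_ball.1 hx])
    rw [indicator_of_mem hx, inter_eq_left.2 hsub, Measure.addHaar_ball_center volume x]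
  · simp [indicator_of_notMem hx]

/-- Only points of `B_r` contribute to the average over `B_s` when `s + 1 ≤ r`. -/
theorem lintegral_ball_pointSum_le (hg : Measurable g) (φ : Config d) {r s : ℝ} (h : s + 1 ≤ r) :
    ∫⁻ t in ball (0 : Space d) s, pointSum g (ball 0 1) (translate t φ)
      ≤ pointSum g (ball 0 r) φ * volume (ball (0 : Space d) 1) := by
  rw [lintegral_ball_pointSum hg, pointSum, ← lintegral_mul_const _
    (measurable_comp_translate hg φ), ← lintegral_indicator measurableSet_ball]
  refine lintegral_mono fun x => ?_
  by_cases hx : x ∈ ball (0 : Space d) r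
  · rw [indicator_of_mem hx, ← Measure.addHaar_ball_center volume x]
    gcongr
    exact inter_subset_left
  · have hempty : ball x 1 ∩ ball (0 : Space d) s = ∅ := by
      refine eq_empty_of_forall_notMem fun t ht => hx ?_
      have h1 := mem_ball.1 ht.1
      have h2 := mem_ball.1 ht.2
      rw [mem_ball]
      linarith [dist_triangle_left x 0 t]
    simp [hempty]

theorem tendsto_volume_ball_div_of_near {m : ℝ → ℕ} {k : ℝ}
    (h1 : ∀ᶠ R in atTop, R - k ≤ m R) (h2 : ∀ᶠ R in atTop, (m R : ℝ) ≤ R + k) :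
    Tendsto (fun R : ℝ => volume (ball (0 : Space d) (m R)) / volume (ball (0 : Space d) R)) atTop
      (𝓝 1) := by
  refine tendsto_of_tendsto_of_tendsto_of_le_of_le'
    (tendsto_volume_ball_add_div (E := Space d) (-k))
    (tendsto_volume_ball_add_div (E := Space d) k) ?_ ?_
  · filter_upwards [h1] with R hR
    gcongr
    linarith
  · filter_upwards [h2] with R hR
    gcongr

theorem tendsto_nat_of_near {m : ℝ → ℕ} {k : ℝ} (h1 : ∀ᶠ R in atTop, R - k ≤ m R) :
    Tendsto m atTop atTop := by
  rw [← tendsto_natCast_atTop_iff (R := ℝ)]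
  exact tendsto_atTop_mono' _ h1 (tendsto_atTop_add_const_right _ (-k) tendsto_id)

/-- Averages over balls of integral radius may be normalised by the volume of a nearby ball of
real radius. -/
theorem tendsto_div_volume_ball_of_near {I : ℕ → ℝ≥0∞} {a : ℝ≥0∞}
    (hI : Tendsto (fun n : ℕ => (volume (ball (0 : Space d) n))⁻¹ * I n) atTop (𝓝 a))
    (ha : a ≠ ∞) {m : ℝ → ℕ} {k : ℝ}
    (h1 : ∀ᶠ R in atTop, R - k ≤ m R) (h2 : ∀ᶠ R in atTop, (m R : ℝ) ≤ R + k) :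
    Tendsto (fun R : ℝ => (volume (ball (0 : Space d) R))⁻¹ * I (m R)) atTop (𝓝 a) := by
  have hm := tendsto_nat_of_near h1
  have h3 := ENNReal.Tendsto.mul (tendsto_volume_ball_div_of_near (d := d) h1 h2)
    (Or.inr ha) (hI.comp hm) (Or.inr ENNReal.one_ne_top)
  rw [one_mul] at h3
  refine h3.congr' ?_
  filter_upwards [hm.eventually (eventually_gt_atTop 0)] with R hR
  have hpos : volume (ball (0 : Space d) (m R)) ≠ 0 :=
    (measure_ball_pos _ _ (by exact_mod_cast hR)).ne'
  simp only [Function.comp_apply]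
  rw [ENNReal.div_eq_inv_mul, mul_assoc, ← mul_assoc (volume _) (volume _)⁻¹,
    ENNReal.mul_inv_cancel hpos measure_ball_lt_top.ne, one_mul]

/-! ### The empirical autocorrelation of bounded sets -/

/-- The number of points in `C`, as an extended number. -/
noncomputable def count (C : Set (Space d)) (φ : Config d) : ℝ≥0∞ := ((φ.carrier ∩ C).encard : ℝ≥0∞)

theorem measurable_count {C : Set (Space d)} (hC : MeasurableSet C) : Measurable (count C) :=
  measurable_encard hC

theorem count_translate {C : Set (Space d)} (hC : MeasurableSet C) (x : Space d) (φ : Config d) :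
    count C (translate x φ) = ∫⁻ y, C.indicator 1 (y - x) ∂(countMeasure φ) := by
  rw [count, N_translate, ← countMeasure_apply φ (measurable_sub_const x hC),
    ← lintegral_indicator_one (measurable_sub_const x hC)]
  rfl

theorem empiricalAutocorrelation_apply (φ : Config d) (R : ℝ) {C : Set (Space d)}
    (hC : MeasurableSet C) :
    empiricalAutocorrelation φ R C = (volume (ball (0 : Space d) R))⁻¹ *
      ∫⁻ x in ball 0 R, (∫⁻ y in ball 0 R, C.indicator 1 (y - x) ∂(countMeasure φ))
        ∂(countMeasure φ) := by
  have hm : Measurable fun p : Space d × Space d => C.indicator (1 : Space d → ℝ≥0∞) (p.2 - p.1) :=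
    (measurable_one.indicator hC).comp (measurable_snd.sub measurable_fst)
  have hm2 : Measurable fun x : Space d =>
      ∫⁻ y in ball 0 R, C.indicator (1 : Space d → ℝ≥0∞) (y - x) ∂(countMeasure φ) :=
    Measurable.lintegral_prod_right hm
  rw [setLIntegral_countMeasure φ hm2 measurableSet_ball]
  have h1 (x : Space d) : ∫⁻ y in ball 0 R, C.indicator (1 : Space d → ℝ≥0∞) (y - x)
      ∂(countMeasure φ) = ∑' y : ↥(φ.carrier ∩ ball 0 R), C.indicator 1 ((y : Space d) - x) :=
    setLIntegral_countMeasure φ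
      ((measurable_one.indicator hC).comp (measurable_sub_const x)) measurableSet_ball
  simp_rw [h1]
  rw [empiricalAutocorrelation, Measure.smul_apply, Measure.sum_apply _ hC, smul_eq_mul]
  simp_rw [Measure.dirac_apply' _ hC]
  exact congrArg _ (ENNReal.tsum_prod (f := fun x y : ↥(φ.carrier ∩ ball 0 R) =>
    C.indicator (1 : Space d → ℝ≥0∞) ((y : Space d) - x)))

theorem empiricalAutocorrelation_le (φ : Config d) (R : ℝ) {C : Set (Space d)}
    (hC : MeasurableSet C) :
    empiricalAutocorrelation φ R C
      ≤ (volume (ball (0 : Space d) R))⁻¹ * pointSum (count C) (ball 0 R) φ := by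
  rw [empiricalAutocorrelation_apply φ R hC, pointSum]
  simp_rw [count_translate hC]
  gcongr
  exact Measure.restrict_le_self

/-- A point of `B_{R - c}` has all its partners at a difference in `C ⊆ B_c` inside `B_R`. -/
theorem le_empiricalAutocorrelation (φ : Config d) (R : ℝ) {C : Set (Space d)} {c : ℝ}
    (hc : 0 ≤ c) (hC : MeasurableSet C) (hCc : C ⊆ ball 0 c) :
    (volume (ball (0 : Space d) R))⁻¹ * pointSum (count C) (ball 0 (R - c)) φ
      ≤ empiricalAutocorrelation φ R C := by
  rw [empiricalAutocorrelation_apply φ R hC, pointSum]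
  simp_rw [count_translate hC]
  gcongr 1
  refine (setLIntegral_mono' measurableSet_ball fun x hx => ?_).trans
    (lintegral_mono_set (ball_subset_ball (by linarith)))
  rw [← lintegral_indicator measurableSet_ball]
  refine lintegral_mono fun y => ?_
  by_cases hy : y - x ∈ C
  · rw [indicator_of_mem (s := ball (0 : Space d) R)]
    have h1 := mem_ball_zero_iff.1 (hCc hy)
    have h2 := mem_ball_zero_iff.1 hx
    rw [mem_ball_zero_iff]
    calc ‖y‖ = ‖(y - x) + x‖ := by simp
      _ ≤ ‖y - x‖ + ‖x‖ := norm_add_le _ _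
      _ < R := by linarith
  · simp [hy]

theorem pointSum_count_le (φ : Config d) {C : Set (Space d)} {r c : ℝ}
    (hc : 0 ≤ c) (hC : MeasurableSet C) (hCc : C ⊆ ball 0 c) :
    pointSum (count C) (closedBall 0 r) φ ≤ (N (closedBall 0 (r + c)) φ : ℝ≥0∞) ^ 2 := by
  have h1 : ∀ x ∈ closedBall (0 : Space d) r,
      count C (translate x φ) ≤ (N (closedBall 0 (r + c)) φ : ℝ≥0∞) := by
    intro x hx
    rw [count, N_translate, ← encard_eq_N φ isBounded_closedBall,
      ← countMeasure_apply φ (measurable_sub_const x hC),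
      ← countMeasure_apply φ measurableSet_closedBall]
    refine measure_mono fun y hy => ?_
    have h1 := mem_ball_zero_iff.1 (hCc hy)
    have h2 := mem_closedBall_zero_iff.1 hx
    rw [mem_closedBall_zero_iff]
    calc ‖y‖ = ‖(y - x) + x‖ := by simp
      _ ≤ ‖y - x‖ + ‖x‖ := norm_add_le _ _
      _ ≤ r + c := by linarith
  calc pointSum (count C) (closedBall 0 r) φ
      ≤ ∫⁻ _ in closedBall (0 : Space d) r, (N (closedBall 0 (r + c)) φ : ℝ≥0∞)
        ∂(countMeasure φ) := setLIntegral_mono' measurableSet_closedBall h1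
    _ = N (closedBall 0 (r + c)) φ * countMeasure φ (closedBall 0 r) := setLIntegral_const _ _
    _ ≤ N (closedBall 0 (r + c)) φ * countMeasure φ (closedBall 0 (r + c)) := by
        gcongr
        linarith
    _ = _ := by
        rw [countMeasure_apply φ measurableSet_closedBall, encard_eq_N φ isBounded_closedBall, sq]

section Law

variable {Q : Measure (Config d)} [IsProbabilityMeasure Q]

theorem campbell_count_lt_top (hsq : ∀ r : ℝ, ∫⁻ φ, (N (closedBall 0 r) φ : ℝ≥0∞) ^ 2 ∂Q < ∞)
    {C : Set (Space d)} (hb : Bornology.IsBounded C) (hC : MeasurableSet C) (r : ℝ) :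
    campbell Q (count C) (closedBall 0 r) < ∞ := by
  obtain ⟨c, hc, hCc⟩ := hb.subset_ball_lt 0 0
  rw [campbell_apply Q (measurable_count hC) measurableSet_closedBall]
  exact (lintegral_mono fun φ => pointSum_count_le φ hc.le hC hCc).trans_lt (hsq _)

theorem campbell_count_eq (hstat : Stationary Q)
    (hsq : ∀ r : ℝ, ∫⁻ φ, (N (closedBall 0 r) φ : ℝ≥0∞) ^ 2 ∂Q < ∞)
    {B : Set (Space d)} (hB : MeasurableSet B) (hB0 : 0 < volume B) (hBfin : volume B < ∞)
    {C : Set (Space d)} (hb : Bornology.IsBounded C) (hC : MeasurableSet C) (A : Set (Space d)) :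
    campbell Q (count C) A = intensity (palm Q B hB) C * volume A := by
  have : IsFiniteMeasureOnCompacts (campbell Q (count C)) := ⟨fun K hK => by
    obtain ⟨r, hr⟩ := hK.isBounded.subset_closedBall 0
    exact (measure_mono hr).trans_lt (campbell_count_lt_top hsq hb hC r)⟩
  rw [campbell_eq hstat (measurable_count hC) hB hB0 hBfin A, intensity_apply _ hC]
  rfl

theorem intensity_palm_lt_top (hstat : Stationary Q)
    (hsq : ∀ r : ℝ, ∫⁻ φ, (N (closedBall 0 r) φ : ℝ≥0∞) ^ 2 ∂Q < ∞)
    {B : Set (Space d)} (hB : MeasurableSet B) (hB0 : 0 < volume B) (hBfin : volume B < ∞)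
    {C : Set (Space d)} (hb : Bornology.IsBounded C) (hC : MeasurableSet C) :
    intensity (palm Q B hB) C < ∞ := by
  have h1 := campbell_count_lt_top hsq hb hC 1
  rw [campbell_count_eq hstat hsq hB hB0 hBfin hb hC] at h1
  by_contra h
  rw [not_lt_top_iff] at h
  rw [h, ENNReal.top_mul (measure_closedBall_pos _ _ one_pos).ne'] at h1
  exact lt_irrefl _ h1

theorem isLocallyFiniteMeasure_intensity_palm (hstat : Stationary Q)
    (hsq : ∀ r : ℝ, ∫⁻ φ, (N (closedBall 0 r) φ : ℝ≥0∞) ^ 2 ∂Q < ∞)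
    {B : Set (Space d)} (hB : MeasurableSet B) (hB0 : 0 < volume B) (hBfin : volume B < ∞) :
    IsLocallyFiniteMeasure (intensity (palm Q B hB)) :=
  ⟨fun x => ⟨ball x 1, ball_mem_nhds x one_pos,
    intensity_palm_lt_top hstat hsq hB hB0 hBfin isBounded_ball measurableSet_ball⟩⟩

theorem pointSum_count_ne_top (φ : Config d) {C : Set (Space d)} (hb : Bornology.IsBounded C)
    (hC : MeasurableSet C) : pointSum (count C) (ball 0 1) φ ≠ ∞ := by
  obtain ⟨c, hc, hCc⟩ := hb.subset_ball_lt 0 0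
  refine (((pointSum_mono ball_subset_closedBall φ).trans
    (pointSum_count_le φ hc.le hC hCc)).trans_lt ?_).ne
  exact ENNReal.pow_lt_top (ENNReal.natCast_lt_top _)

/-- The empirical autocorrelation of a bounded set lies between two ergodic averages of the local
sum `φ ↦ ∑_{x ∈ φ ∩ B_1} N_C (φ - x)` over balls whose radii differ from `R` by a bounded
amount. -/
theorem ae_tendsto_empiricalAutocorrelation (hstat : Stationary Q) (herg : Ergodic Q)
    (hsq : ∀ r : ℝ, ∫⁻ φ, (N (closedBall 0 r) φ : ℝ≥0∞) ^ 2 ∂Q < ∞)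
    {B : Set (Space d)} (hB : MeasurableSet B) (hB0 : 0 < volume B) (hBfin : volume B < ∞)
    {C : Set (Space d)} (hb : Bornology.IsBounded C) (hC : MeasurableSet C) :
    ∀ᵐ φ ∂Q, Tendsto (fun R : ℝ => empiricalAutocorrelation φ R C) atTop
      (𝓝 (intensity (palm Q B hB) C)) := by
  have hg : Measurable (count C) := measurable_count hC
  have hv0 : volume (ball (0 : Space d) 1) ≠ 0 := (measure_ball_pos _ _ one_pos).ne'
  have hvt : volume (ball (0 : Space d) 1) ≠ ∞ := measure_ball_lt_top.ne
  have hfin := intensity_palm_lt_top hstat hsq hB hB0 hBfin hb hC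
  have hmean : ∫⁻ φ, pointSum (count C) (ball 0 1) φ ∂Q
      = intensity (palm Q B hB) C * volume (ball (0 : Space d) 1) := by
    rw [← campbell_apply Q hg measurableSet_ball,
      campbell_count_eq hstat hsq hB hB0 hBfin hb hC]
  have hmean' : intensity (palm Q B hB) C * volume (ball (0 : Space d) 1) ≠ ∞ :=
    ENNReal.mul_ne_top hfin.ne hvt
  obtain ⟨c, hc, hCc⟩ := hb.subset_ball_lt 0 0
  filter_upwards [(isErgodicFlow_translate hstat herg).ae_tendsto_laverage
    (measurable_pointSum hg measurableSet_ball) (fun φ => pointSum_count_ne_top φ hb hC)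
    (hmean ▸ hmean')] with φ hφ
  rw [hmean] at hφ
  set I : ℕ → ℝ≥0∞ := fun n =>
    ∫⁻ t in ball (0 : Space d) n, pointSum (count C) (ball 0 1) (translate t φ) with hI
  have hfloor : ∀ᶠ R : ℝ in atTop, 0 ≤ R - c - 1 := by
    filter_upwards [eventually_ge_atTop (c + 1)] with R hR
    linarith
  have hlow := tendsto_div_volume_ball_of_near (I := I) hφ hmean'
    (m := fun R => ⌊R - c - 1⌋₊) (k := c + 2)
    (.of_forall fun R => by linarith [Nat.lt_floor_add_one (R - c - 1)])
    (by filter_upwards [hfloor] with R hR; linarith [Nat.floor_le hR])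
  have hup := tendsto_div_volume_ball_of_near (I := I) hφ hmean'
    (m := fun R => ⌈R + 1⌉₊) (k := 2)
    (.of_forall fun R => by linarith [Nat.le_ceil (R + 1)])
    (by
      filter_upwards [eventually_ge_atTop 0] with R hR
      linarith [Nat.ceil_lt_add_one (show 0 ≤ R + 1 by linarith)])
  have hdiv {f : ℝ → ℝ≥0∞}
      (hf : Tendsto f atTop (𝓝 (intensity (palm Q B hB) C * volume (ball (0 : Space d) 1)))) :
      Tendsto (fun R => f R / volume (ball (0 : Space d) 1)) atTop
        (𝓝 (intensity (palm Q B hB) C)) := by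
    have h := ENNReal.Tendsto.div_const hf (Or.inr hv0)
    rwa [ENNReal.mul_div_cancel_right hv0 hvt] at h
  refine tendsto_of_tendsto_of_tendsto_of_le_of_le' (hdiv hlow) (hdiv hup) ?_ ?_
  · filter_upwards [hfloor] with R hR
    refine le_trans ?_ (le_empiricalAutocorrelation φ R hc.le hC hCc)
    rw [mul_div_assoc]
    gcongr
    refine ENNReal.div_le_of_le_mul ?_
    exact lintegral_ball_pointSum_le hg φ (by linarith [Nat.floor_le hR])
  · refine .of_forall fun R => (empiricalAutocorrelation_le φ R hC).trans ?_
    rw [mul_div_assoc]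
    gcongr
    rw [ENNReal.le_div_iff_mul_le (Or.inl hv0) (Or.inl hvt)]
    exact pointSum_mul_volume_le hg φ (Nat.le_ceil _)

end Law

end PointProcess

/-! ### Vague convergence from convergence on countably many sets -/

namespace PointProcess

variable {d : ℕ}

/-- The points of the ball of radius `k` for which the nearest of the first `n + 1` terms of a
dense sequence is the term of index `i`. -/
noncomputable def cell (d n k i : ℕ) : Set (Space d) :=
  SimpleFunc.nearestPtInd (denseSeq (Space d)) n ⁻¹' {i} ∩ closedBall 0 k

theorem measurableSet_cell (n k i : ℕ) : MeasurableSet (cell d n k i) :=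
  ((SimpleFunc.nearestPtInd (denseSeq (Space d)) n).measurableSet_fiber i).inter
    measurableSet_closedBall

theorem isBounded_cell (n k i : ℕ) : Bornology.IsBounded (cell d n k i) :=
  isBounded_closedBall.subset inter_subset_right

/-- A continuous function with compact support is uniformly close to a function that is constant
on finitely many cells and vanishes elsewhere. -/
theorem exists_forall_dist_nearestPt_le (f : C_c(Space d, ℝ)) (k : ℕ) {ε : ℝ} (hε : 0 < ε) :
    ∃ n : ℕ, ∀ x ∈ closedBall (0 : Space d) k,
      |f x - f (SimpleFunc.nearestPt (denseSeq (Space d)) n x)| ≤ ε := by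
  have huc : UniformContinuous f := f.hasCompactSupport'.uniformContinuous_of_continuous
    f.continuous
  obtain ⟨δ, hδ, hf⟩ := Metric.uniformContinuous_iff.1 huc ε hε
  obtain ⟨t, ht⟩ := (isCompact_closedBall (0 : Space d) (k : ℝ)).elim_finite_subcover
    (fun i : ℕ => ball (denseSeq (Space d) i) δ) (fun i => isOpen_ball) (fun x _ => by
      obtain ⟨i, hi⟩ := (denseRange_denseSeq (Space d)).exists_dist_lt x hδ
      exact mem_iUnion.2 ⟨i, hi⟩)
  refine ⟨t.sup id, fun x hx => ?_⟩
  obtain ⟨i, hi, hxi⟩ := mem_iUnion₂.1 (ht hx)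
  have h1 := SimpleFunc.edist_nearestPt_le (denseSeq (Space d)) x (Finset.le_sup (f := id) hi)
  rw [id, edist_dist, edist_dist, ENNReal.ofReal_le_ofReal_iff dist_nonneg] at h1
  rw [mem_ball, dist_comm] at hxi
  have h2 := hf (h1.trans_lt hxi)
  rw [Real.dist_eq, abs_sub_comm] at h2
  exact h2.le

theorem integrable_of_support_subset {μ : Measure (Space d)} (f : C_c(Space d, ℝ))
    {K : Set (Space d)} (hK : μ K < ∞) (hf : Function.support f ⊆ K) : Integrable f μ := by
  rw [← integrableOn_iff_integrable_of_support_subset hf]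
  obtain ⟨C, hC⟩ := f.hasCompactSupport'.exists_bound_of_continuous f.continuous
  exact .of_bound hK f.continuous.aestronglyMeasurable C (.of_forall hC)

theorem abs_integral_sub_sum_cell_le (f : C_c(Space d, ℝ)) {k n : ℕ} {ε : ℝ}
    (hf : Function.support f ⊆ closedBall 0 k)
    (hn : ∀ x ∈ closedBall (0 : Space d) k,
      |f x - f (SimpleFunc.nearestPt (denseSeq (Space d)) n x)| ≤ ε)
    {μ : Measure (Space d)} (hμ : μ (closedBall 0 k) < ∞) :
    |(∫ x, f x ∂μ) - ∑ i ∈ Finset.range (n + 1), f (denseSeq (Space d) i) * μ.real (cell d n k i)|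
      ≤ ε * μ.real (closedBall 0 k) := by
  have hcell (i : ℕ) : μ (cell d n k i) < ∞ := (measure_mono inter_subset_right).trans_lt hμ
  have hsum : ∑ i ∈ Finset.range (n + 1), f (denseSeq (Space d) i) * μ.real (cell d n k i)
      = ∫ x in closedBall 0 k, f (SimpleFunc.nearestPt (denseSeq (Space d)) n x) ∂μ := by
    have h1 : ∀ x ∈ closedBall (0 : Space d) k,
        f (SimpleFunc.nearestPt (denseSeq (Space d)) n x)
        = ∑ i ∈ Finset.range (n + 1),
          (cell d n k i).indicator (fun _ => f (denseSeq (Space d) i)) x := by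
      intro x hx
      rw [Finset.sum_eq_single (SimpleFunc.nearestPtInd (denseSeq (Space d)) n x)]
      · rw [indicator_of_mem (show x ∈ cell d n k _ from ⟨rfl, hx⟩)]
        rfl
      · intro i _ hi
        rw [indicator_of_notMem]
        exact fun h => hi (Eq.symm h.1)
      · intro h
        exact absurd (Finset.mem_range.2 (Nat.lt_succ_of_le (SimpleFunc.nearestPtInd_le _ n x))) h
    rw [setIntegral_congr_fun measurableSet_closedBall h1, integral_finsetSum]
    · refine Finset.sum_congr rfl fun i _ => ?_
      rw [integral_indicator (measurableSet_cell n k i), setIntegral_const, smul_eq_mul, mul_comm,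
        Measure.real, Measure.real, Measure.restrict_apply (measurableSet_cell n k i),
        inter_eq_left.2 (show cell d n k i ⊆ closedBall 0 k from inter_subset_right)]
    · intro i _
      refine (integrable_indicator_iff (measurableSet_cell n k i)).2 (integrableOn_const ?_)
      exact ((Measure.restrict_apply_le _ _).trans_lt (hcell i)).ne
  have hfi := integrable_of_support_subset f hμ hf
  have hni : IntegrableOn (fun x => f (SimpleFunc.nearestPt (denseSeq (Space d)) n x))
      (closedBall 0 k) μ := by
    obtain ⟨C, hC⟩ := f.hasCompactSupport'.exists_bound_of_continuous f.continuous
    exact .of_bound hμ (f.continuous.measurable.comp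
      (SimpleFunc.measurable _)).aestronglyMeasurable C (.of_forall fun x => hC _)
  rw [hsum, ← setIntegral_eq_integral_of_forall_compl_eq_zero (s := closedBall (0 : Space d) k)
    (fun x hx => Function.notMem_support.1 fun h => hx (hf h)), ← integral_sub hfi.integrableOn hni]
  exact norm_setIntegral_le_of_norm_le_const (f := fun x =>
    f x - f (SimpleFunc.nearestPt (denseSeq (Space d)) n x)) hμ hn

/-- Convergence on all the cells and all the balls of integral radius implies vague
convergence. -/
theorem tendsto_integral_of_tendsto_cell {ι : Type*} {l : Filter ι}
    {μs : ι → Measure (Space d)} {μ : Measure (Space d)} [IsFiniteMeasureOnCompacts μ]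
    (hball : ∀ k : ℕ, Tendsto (fun i => μs i (closedBall 0 k)) l (𝓝 (μ (closedBall 0 k))))
    (hcell : ∀ n k j : ℕ, Tendsto (fun i => μs i (cell d n k j)) l (𝓝 (μ (cell d n k j))))
    (f : C_c(Space d, ℝ)) : Tendsto (fun i => ∫ x, f x ∂(μs i)) l (𝓝 (∫ x, f x ∂μ)) := by
  obtain ⟨r, hr⟩ := f.hasCompactSupport'.isCompact.isBounded.subset_closedBall (0 : Space d)
  obtain ⟨k, hk⟩ := exists_nat_ge r
  have hsupp : Function.support f ⊆ closedBall 0 (k : ℝ) :=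
    (subset_tsupport f).trans (hr.trans (closedBall_subset_closedBall hk))
  have hfin : μ (closedBall 0 k) < ∞ := (isCompact_closedBall _ _).measure_lt_top
  set M := μ.real (closedBall (0 : Space d) k) with hM
  have hM0 : 0 ≤ M := measureReal_nonneg
  have hballr : Tendsto (fun i => (μs i).real (closedBall 0 k)) l (𝓝 M) :=
    (ENNReal.tendsto_toReal hfin.ne).comp (hball k)
  rw [Metric.tendsto_nhds]
  intro ε hε
  -- Both approximation errors are at most `η * (M + 1) = ε / 3`, since eventually the ball has
  -- mass less than `M + 1`.
  set η := ε / (3 * (M + 1)) with hη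
  have hη0 : 0 < η := by positivity
  have hη1 : η * (M + 1) = ε / 3 := by rw [hη]; field_simp
  obtain ⟨n, hn⟩ := exists_forall_dist_nearestPt_le f k hη0
  have hsum : Tendsto (fun i => ∑ j ∈ Finset.range (n + 1),
      f (denseSeq (Space d) j) * (μs i).real (cell d n k j)) l
      (𝓝 (∑ j ∈ Finset.range (n + 1), f (denseSeq (Space d) j) * μ.real (cell d n k j))) := by
    refine tendsto_finsetSum _ fun j _ => Tendsto.const_mul _ ?_
    refine (ENNReal.tendsto_toReal ?_).comp (hcell n k j)
    exact ((measure_mono inter_subset_right).trans_lt hfin).ne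
  filter_upwards [(hball k).eventually (gt_mem_nhds hfin),
    hballr.eventually (gt_mem_nhds (lt_add_one M)),
    (Metric.tendsto_nhds.1 hsum) (ε / 3) (by positivity)] with i h1 h2 h3
  have h4 := abs_integral_sub_sum_cell_le f hsupp hn h1
  have h5 := abs_integral_sub_sum_cell_le f hsupp hn hfin
  have h6 : η * (μs i).real (closedBall 0 k) ≤ η * (M + 1) :=
    mul_le_mul_of_nonneg_left h2.le hη0.le
  have h7 : η * M ≤ η * (M + 1) := mul_le_mul_of_nonneg_left (by linarith) hη0.le
  rw [Real.dist_eq] at h3 ⊢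
  rw [abs_lt] at h3 ⊢
  rw [abs_le] at h4 h5
  constructor <;> linarith [h3.1, h3.2, h4.1, h4.2, h5.1, h5.2]

/-- Countably many cells and balls suffice for vague convergence, so the exceptional null sets
can be merged into one. -/
theorem ae_isAutocorrelation {Q : Measure (Config d)} [IsProbabilityMeasure Q]
    (hstat : Stationary Q) (herg : Ergodic Q)
    (hsq : ∀ r : ℝ, ∫⁻ φ, (N (closedBall 0 r) φ : ℝ≥0∞) ^ 2 ∂Q < ∞)
    {B : Set (Space d)} (hB : MeasurableSet B) (hB0 : 0 < volume B) (hBfin : volume B < ∞) :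
    ∀ᵐ φ ∂Q, IsAutocorrelation φ (intensity (palm Q B hB)) := by
  have hloc := isLocallyFiniteMeasure_intensity_palm hstat hsq hB hB0 hBfin
  have h1 : ∀ᵐ φ ∂Q, ∀ k : ℕ, Tendsto
      (fun R : ℝ => empiricalAutocorrelation φ R (closedBall 0 k)) atTop
      (𝓝 (intensity (palm Q B hB) (closedBall 0 k))) := ae_all_iff.2 fun k =>
    ae_tendsto_empiricalAutocorrelation hstat herg hsq hB hB0 hBfin isBounded_closedBall
      measurableSet_closedBall
  have h2 : ∀ᵐ φ ∂Q, ∀ n k j : ℕ, Tendsto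
      (fun R : ℝ => empiricalAutocorrelation φ R (cell d n k j)) atTop
      (𝓝 (intensity (palm Q B hB) (cell d n k j))) := by
    simp only [ae_all_iff]
    exact fun n k j => ae_tendsto_empiricalAutocorrelation hstat herg hsq hB hB0 hBfin
      (isBounded_cell n k j) (measurableSet_cell n k j)
  filter_upwards [h1, h2] with φ h1 h2
  exact ⟨hloc, fun f => tendsto_integral_of_tendsto_cell h1 h2 f⟩

end PointProcess

/-! ### Vague convergence of uniformly tempered measures -/

namespace PointProcess

variable {d : ℕ}

/-- The weight `(1 + ‖x‖) ^ (-(d + 1))`, integrable for Lebesgue measure on `ℝ^d`. -/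
noncomputable def weight (x : Space d) : ℝ := (1 + ‖x‖) ^ (-((d + 1 : ℕ) : ℝ))

theorem weight_pos (x : Space d) : 0 < weight x := by
  unfold weight
  positivity

theorem continuous_weight : Continuous (weight (d := d)) := by
  unfold weight
  exact (continuous_const.add continuous_norm).rpow_const fun x => Or.inl
    (add_pos_of_pos_of_nonneg one_pos (norm_nonneg x)).ne'

/-- The integral of the weight. -/
noncomputable def weightMass (μ : Measure (Space d)) : ℝ≥0∞ := ∫⁻ x, ENNReal.ofReal (weight x) ∂μ

theorem integrable_weight_volume : Integrable (weight (d := d)) :=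
  integrable_one_add_norm (by rw [finrank_euclideanSpace_fin]; push_cast; linarith)

theorem integrable_weight {μ : Measure (Space d)} (h : weightMass μ < ∞) :
    Integrable weight μ := by
  refine ⟨continuous_weight.aestronglyMeasurable, ?_⟩
  rw [hasFiniteIntegral_iff_ofReal (.of_forall fun x => (weight_pos x).le)]
  exact h

theorem integral_weight_le {μ : Measure (Space d)} {K : ℝ≥0} (h : weightMass μ ≤ K) :
    ∫ x, weight x ∂μ ≤ K := by
  rw [integral_eq_lintegral_of_nonneg_ae (.of_forall fun x => (weight_pos x).le)
    continuous_weight.aestronglyMeasurable]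
  exact ENNReal.toReal_le_of_le_ofReal K.2 (by simpa [weightMass] using h)

theorem hasTemperateGrowth_of_weightMass {μ : Measure (Space d)} (h : weightMass μ < ∞) :
    μ.HasTemperateGrowth :=
  ⟨⟨d + 1, integrable_weight h⟩⟩

theorem exists_mul_weight_ge {f : Space d → ℝ} (hf : Continuous f) (hs : HasCompactSupport f) :
    ∃ C : ℝ, 0 ≤ C ∧ ∀ x, |f x| ≤ C * weight x := by
  obtain ⟨C, hC⟩ := (hs.mul_right (f' := fun x => (weight x)⁻¹)).exists_bound_of_continuous
    (hf.mul (continuous_weight.inv₀ fun x => (weight_pos x).ne'))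
  refine ⟨C, (norm_nonneg _).trans (hC 0), fun x => ?_⟩
  have h := hC x
  rw [Pi.mul_apply, norm_mul, norm_inv, Real.norm_of_nonneg (weight_pos x).le,
    ← div_eq_mul_inv, div_le_iff₀ (weight_pos x)] at h
  exact h

theorem integrable_of_le_weight {F : Type*} [NormedAddCommGroup F] {μ : Measure (Space d)}
    (h : weightMass μ < ∞) {f : Space d → F} (hf : Continuous f) {C : ℝ}
    (hC : ∀ x, ‖f x‖ ≤ C * weight x) : Integrable f μ :=
  ((integrable_weight h).const_mul C).mono' hf.aestronglyMeasurable (.of_forall hC)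

theorem integrable_compactlySupported {μ : Measure (Space d)} (h : weightMass μ < ∞)
    (f : C_c(Space d, ℝ)) : Integrable f μ := by
  obtain ⟨C, _, hC⟩ := exists_mul_weight_ge f.continuous f.hasCompactSupport'
  exact integrable_of_le_weight h f.continuous hC

theorem exists_cutoff (z : Space d) (r : ℝ) : ∃ f : C_c(Space d, ℝ),
    (∀ x, 0 ≤ f x ∧ f x ≤ 1) ∧ ∀ x ∈ closedBall z r, f x = 1 := by
  obtain ⟨f, h1, h2, -, h4⟩ := exists_continuousMap_one_of_isCompact_subset_isOpen
    (isCompact_closedBall z r) isOpen_univ (subset_univ _)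
  exact ⟨⟨f, h2⟩, h4, fun x hx => h1 hx⟩

/-- A measure with uniformly bounded mass on the unit balls has finite weighted mass. -/
theorem exists_weightMass_le (d : ℕ) : ∃ C : ℝ≥0, ∀ (μ : Measure (Space d)) [SFinite μ] (K : ℝ≥0),
    (∀ z, μ (ball z 1) ≤ K) → weightMass μ ≤ ((C * K : ℝ≥0) : ℝ≥0∞) := by
  set v := volume (ball (0 : Space d) 1) with hv
  have hv0 : v ≠ 0 := (measure_ball_pos _ _ one_pos).ne'
  have hvt : v ≠ ∞ := measure_ball_lt_top.ne
  have hW : ∫⁻ x : Space d, ENNReal.ofReal (weight x) ≠ ∞ :=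
    integrable_weight_volume.lintegral_lt_top.ne
  have hC : 2 ^ (d + 1) * (∫⁻ x : Space d, ENNReal.ofReal (weight x)) / v ≠ ∞ :=
    ENNReal.div_ne_top (ENNReal.mul_ne_top (by finiteness) hW) hv0
  refine ⟨(2 ^ (d + 1) * (∫⁻ x : Space d, ENNReal.ofReal (weight x)) / v).toNNReal,
    fun μ _ K hK => ?_⟩
  rw [ENNReal.coe_mul, ENNReal.coe_toNNReal hC]
  have hm : Measurable fun x : Space d => ENNReal.ofReal (weight x) :=
    continuous_weight.measurable.ennreal_ofReal
  have hcomp (x z : Space d) (hz : z ∈ ball x 1) :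
      ENNReal.ofReal (weight x) ≤ 2 ^ (d + 1) * ENNReal.ofReal (weight z) := by
    rw [show (2 : ℝ≥0∞) ^ (d + 1) = ENNReal.ofReal (2 ^ (d + 1)) by
      rw [ENNReal.ofReal_pow (by norm_num)]; norm_num,
      ← ENNReal.ofReal_mul (by positivity)]
    refine ENNReal.ofReal_le_ofReal ?_
    have h1 : 1 + ‖z‖ ≤ 2 * (1 + ‖x‖) := by
      have h2 : ‖z‖ ≤ ‖z - x‖ + ‖x‖ := by simpa using norm_add_le (z - x) x
      have h3 := mem_ball_iff_norm.1 hz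
      linarith [norm_nonneg x]
    simp only [weight, Real.rpow_neg (show 0 ≤ 1 + ‖x‖ by positivity),
      Real.rpow_neg (show 0 ≤ 1 + ‖z‖ by positivity), Real.rpow_natCast]
    rw [inv_le_iff_one_le_mul₀ (by positivity), mul_assoc, mul_comm, mul_assoc,
      ← mul_pow, inv_mul_eq_div, le_div_iff₀ (by positivity), one_mul, mul_comm]
    exact pow_le_pow_left₀ (by positivity) h1 _
  -- The weight varies by a bounded factor on unit balls, so it may be replaced by its average there.
  have h1 : weightMass μ * v
      ≤ 2 ^ (d + 1) *
        ∫⁻ x, (∫⁻ z, (ball x 1).indicator (fun z => ENNReal.ofReal (weight z)) z) ∂μ := by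
    rw [weightMass, ← lintegral_mul_const _ hm, ← lintegral_const_mul']
    swap; · finiteness
    refine lintegral_mono fun x => ?_
    rw [lintegral_indicator measurableSet_ball, ← lintegral_const_mul _ hm, hv,
      ← Measure.addHaar_ball_center volume x, ← setLIntegral_const]
    exact setLIntegral_mono' measurableSet_ball (hcomp x)
  have hm2 : Measurable (Function.uncurry fun x z : Space d =>
      (ball x 1).indicator (fun z => ENNReal.ofReal (weight z)) z) := by
    have hs : MeasurableSet {p : Space d × Space d | dist p.2 p.1 < 1} :=
      measurableSet_lt (measurable_snd.dist measurable_fst) measurable_const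
    exact (hm.comp measurable_snd).indicator hs
  have h2 : ∫⁻ x, (∫⁻ z, (ball x 1).indicator (fun z => ENNReal.ofReal (weight z)) z) ∂μ
      ≤ (∫⁻ x : Space d, ENNReal.ofReal (weight x)) * K := by
    rw [lintegral_lintegral_swap hm2.aemeasurable, ← lintegral_mul_const _ hm]
    refine lintegral_mono fun z => ?_
    have h3 (x : Space d) : (ball x 1).indicator (fun z => ENNReal.ofReal (weight z)) z
        = (ball z 1).indicator (fun _ => ENNReal.ofReal (weight z)) x := by
      simp only [indicator, mem_ball, dist_comm]
    simp_rw [h3]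
    rw [lintegral_indicator_const measurableSet_ball]
    gcongr
    exact hK z
  rw [mul_comm _ (K : ℝ≥0∞), ← mul_div_assoc, ENNReal.le_div_iff_mul_le (Or.inl hv0) (Or.inl hvt)]
  exact h1.trans ((mul_le_mul_right h2 _).trans_eq (by ring))

/-- The weighted mass is lower semicontinuous for vague convergence. -/
theorem weightMass_le_of_tendsto {ι : Type*} {l : Filter ι} [l.NeBot]
    {μs : ι → Measure (Space d)} {μ : Measure (Space d)} [IsFiniteMeasureOnCompacts μ] {K : ℝ≥0}
    (hK : ∀ᶠ i in l, weightMass (μs i) ≤ K)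
    (hlim : ∀ f : C_c(Space d, ℝ), Tendsto (fun i => ∫ x, f x ∂(μs i)) l (𝓝 (∫ x, f x ∂μ))) :
    weightMass μ ≤ K := by
  choose χ h01 h1 using fun n : ℕ => exists_cutoff (0 : Space d) n
  let f (n : ℕ) : C_c(Space d, ℝ) :=
    ⟨⟨fun x => χ n x * weight x, (χ n).continuous.mul continuous_weight⟩,
      (χ n).hasCompactSupport'.mul_right⟩
  have hf0 (n : ℕ) (x : Space d) : 0 ≤ f n x := mul_nonneg (h01 n x).1 (weight_pos x).le
  have hf1 (n : ℕ) (x : Space d) : f n x ≤ weight x :=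
    mul_le_of_le_one_left (weight_pos x).le (h01 n x).2
  have hn (n : ℕ) : ∫⁻ x, ENNReal.ofReal (f n x) ∂μ ≤ K := by
    rw [← ofReal_integral_eq_lintegral_ofReal (f n).integrable (.of_forall (hf0 n)),
      ← ENNReal.ofReal_coe_nnreal]
    refine ENNReal.ofReal_le_ofReal (le_of_tendsto (hlim (f n)) ?_)
    filter_upwards [hK] with i hi
    have hw := integrable_weight (hi.trans_lt ENNReal.coe_lt_top)
    exact (integral_mono_of_nonneg (.of_forall (hf0 n)) hw (.of_forall (hf1 n))).trans
      (integral_weight_le hi)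
  have hpt (x : Space d) : Tendsto (fun n => ENNReal.ofReal (f n x)) atTop
      (𝓝 (ENNReal.ofReal (weight x))) := by
    refine tendsto_const_nhds.congr' ?_
    obtain ⟨n, hn⟩ := exists_nat_ge ‖x‖
    filter_upwards [eventually_ge_atTop n] with m hm
    have : f m x = χ m x * weight x := rfl
    rw [this, h1 m x, one_mul]
    rw [mem_closedBall_zero_iff]
    exact hn.trans (by exact_mod_cast hm)
  calc weightMass μ = ∫⁻ x, liminf (fun n => ENNReal.ofReal (f n x)) atTop ∂μ :=
        lintegral_congr fun x => (hpt x).liminf_eq.symm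
    _ ≤ liminf (fun n => ∫⁻ x, ENNReal.ofReal (f n x) ∂μ) atTop :=
        lintegral_liminf_le fun n => (f n).continuous.measurable.ennreal_ofReal
    _ ≤ K := liminf_le_of_le (by isBoundedDefault) fun b hb => by
        obtain ⟨n, hn'⟩ := hb.exists
        exact hn'.trans (hn n)

/-- The error made in an integral by a cutoff at radius `r`. -/
theorem norm_integral_sub_cutoff_le {μ : Measure (Space d)} {K : ℝ≥0} (hK : weightMass μ ≤ K)
    {g : Space d → ℂ} (hg : Continuous g) {C : ℝ}
    (hgC : ∀ x, ‖g x‖ ≤ C * (weight x / (1 + ‖x‖))) {r : ℝ} (hr : 0 ≤ r) {χ : C_c(Space d, ℝ)}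
    (h01 : ∀ x, 0 ≤ χ x ∧ χ x ≤ 1) (h1 : ∀ x ∈ closedBall 0 r, χ x = 1) :
    ‖(∫ x, g x ∂μ) - ∫ x, (χ x : ℂ) * g x ∂μ‖ ≤ C / (1 + r) * K := by
  have hC : 0 ≤ C := by
    have := (norm_nonneg _).trans (hgC 0)
    exact nonneg_of_mul_nonneg_left this (div_pos (weight_pos 0) (by positivity))
  have hlt : weightMass μ < ∞ := hK.trans_lt ENNReal.coe_lt_top
  have hgw (x : Space d) : ‖g x‖ ≤ C * weight x := by
    refine (hgC x).trans (mul_le_mul_of_nonneg_left ?_ hC)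
    exact div_le_self (weight_pos x).le (by linarith [norm_nonneg x])
  have hcont : Continuous fun x => (χ x : ℂ) * g x :=
    (Complex.continuous_ofReal.comp χ.continuous).mul hg
  have hχw (x : Space d) : ‖(χ x : ℂ) * g x‖ ≤ C * weight x := by
    rw [norm_mul, Complex.norm_real, Real.norm_of_nonneg (h01 x).1]
    exact (mul_le_of_le_one_left (norm_nonneg _) (h01 x).2).trans (hgw x)
  rw [← integral_sub (integrable_of_le_weight hlt hg hgw) (integrable_of_le_weight hlt hcont hχw)]
  have hpt (x : Space d) : ‖g x - (χ x : ℂ) * g x‖ ≤ C / (1 + r) * weight x := by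
    by_cases hx : x ∈ closedBall 0 r
    · rw [h1 x hx]
      simp only [Complex.ofReal_one, one_mul, sub_self, norm_zero]
      have := (weight_pos x).le
      positivity
    · have hx' : r ≤ ‖x‖ := by
        rw [mem_closedBall_zero_iff, not_le] at hx
        exact hx.le
      have h2 : ‖g x - (χ x : ℂ) * g x‖ ≤ ‖g x‖ := by
        rw [← one_sub_mul, norm_mul, ← Complex.ofReal_one, ← Complex.ofReal_sub, Complex.norm_real,
          Real.norm_of_nonneg (sub_nonneg.2 (h01 x).2)]
        exact mul_le_of_le_one_left (norm_nonneg _) (by linarith [(h01 x).1])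
      refine h2.trans ((hgC x).trans ?_)
      rw [div_mul_eq_mul_div, mul_div_assoc]
      have := (weight_pos x).le
      gcongr
  refine (norm_integral_le_of_norm_le ((integrable_weight hlt).const_mul _)
    (.of_forall hpt)).trans ?_
  rw [integral_const_mul]
  gcongr
  exact integral_weight_le hK

/-- Under a uniform bound on the weighted masses, vague convergence extends to continuous
functions that decay faster than the weight. -/
theorem tendsto_integral_of_decay {ι : Type*} {l : Filter ι}
    {μs : ι → Measure (Space d)} {μ : Measure (Space d)} {K : ℝ≥0}
    (hKs : ∀ᶠ i in l, weightMass (μs i) ≤ K) (hK : weightMass μ ≤ K)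
    (hlim : ∀ f : C_c(Space d, ℝ), Tendsto (fun i => ∫ x, f x ∂(μs i)) l (𝓝 (∫ x, f x ∂μ)))
    {g : Space d → ℂ} (hg : Continuous g) {C : ℝ}
    (hgC : ∀ x, ‖g x‖ ≤ C * (weight x / (1 + ‖x‖))) :
    Tendsto (fun i => ∫ x, g x ∂(μs i)) l (𝓝 (∫ x, g x ∂μ)) := by
  have hcut (χ : C_c(Space d, ℝ)) :
      Tendsto (fun i => ∫ x, (χ x : ℂ) * g x ∂(μs i)) l (𝓝 (∫ x, (χ x : ℂ) * g x ∂μ)) := by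
    let fre : C_c(Space d, ℝ) := ⟨⟨fun x => χ x * (g x).re,
      χ.continuous.mul (Complex.continuous_re.comp hg)⟩, χ.hasCompactSupport'.mul_right⟩
    let fim : C_c(Space d, ℝ) := ⟨⟨fun x => χ x * (g x).im,
      χ.continuous.mul (Complex.continuous_im.comp hg)⟩, χ.hasCompactSupport'.mul_right⟩
    have hsplit {ν : Measure (Space d)} (hν : weightMass ν ≤ K) :
        ∫ x, (χ x : ℂ) * g x ∂ν
          = ((∫ x, fre x ∂ν : ℝ) : ℂ) + ((∫ x, fim x ∂ν : ℝ) : ℂ) * Complex.I := by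
      have hlt : weightMass ν < ∞ := hν.trans_lt ENNReal.coe_lt_top
      rw [← integral_complex_ofReal, ← integral_complex_ofReal, ← integral_mul_const,
        ← integral_add (integrable_compactlySupported hlt fre).ofReal
          ((integrable_compactlySupported hlt fim).ofReal.mul_const _)]
      refine integral_congr_ae (.of_forall fun x => ?_)
      have hre : fre x = χ x * (g x).re := rfl
      have him : fim x = χ x * (g x).im := rfl
      simp only [hre, him]
      push_cast
      conv_lhs => rw [← Complex.re_add_im (g x)]
      ring
    rw [hsplit hK]
    refine Tendsto.congr' (hKs.mono fun i hi => (hsplit hi).symm) ?_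
    exact ((Complex.continuous_ofReal.tendsto _).comp (hlim fre)).add
      (((Complex.continuous_ofReal.tendsto _).comp (hlim fim)).mul_const _)
  rw [Metric.tendsto_nhds]
  intro ε hε
  have hC : 0 ≤ C := nonneg_of_mul_nonneg_left ((norm_nonneg _).trans (hgC 0))
    (div_pos (weight_pos 0) (by positivity))
  obtain ⟨r, hr⟩ := exists_nat_gt (C * K / (ε / 3))
  have hsmall : C / (1 + (r : ℝ)) * K < ε / 3 := by
    rw [div_mul_eq_mul_div, div_lt_iff₀ (by positivity)]
    rw [div_lt_iff₀ (by positivity)] at hr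
    nlinarith
  obtain ⟨χ, h01, h1⟩ := exists_cutoff (0 : Space d) r
  filter_upwards [hKs, (Metric.tendsto_nhds.1 (hcut χ)) (ε / 3) (by positivity)] with i hi h3
  have h4 := norm_integral_sub_cutoff_le hi hg hgC (Nat.cast_nonneg r) h01 h1
  have h5 := norm_integral_sub_cutoff_le hK hg hgC (Nat.cast_nonneg r) h01 h1
  rw [← dist_eq_norm] at h4 h5
  rw [dist_comm] at h5
  linarith [dist_triangle4 (∫ x, g x ∂(μs i)) (∫ x, (χ x : ℂ) * g x ∂(μs i))
    (∫ x, (χ x : ℂ) * g x ∂μ) (∫ x, g x ∂μ)]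

/-- Vague compactness: along an ultrafilter, measures with bounded weighted mass converge
vaguely, the limit being given by the Riesz–Markov–Kakutani theorem. -/
theorem exists_tendsto_of_weightMass_le {ι : Type*} (U : Ultrafilter ι)
    {μs : ι → Measure (Space d)} {K : ℝ≥0} (hK : ∀ᶠ i in (U : Filter ι), weightMass (μs i) ≤ K) :
    ∃ μ : Measure (Space d), IsFiniteMeasureOnCompacts μ ∧
      ∀ f : C_c(Space d, ℝ), Tendsto (fun i => ∫ x, f x ∂(μs i)) U (𝓝 (∫ x, f x ∂μ)) := by
  have hex (f : C_c(Space d, ℝ)) : ∃ a : ℝ, Tendsto (fun i => ∫ x, f x ∂(μs i)) U (𝓝 a) := by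
    obtain ⟨C, hC0, hC⟩ := exists_mul_weight_ge f.continuous f.hasCompactSupport'
    have hb : ∀ᶠ i in (U : Filter ι), ∫ x, f x ∂(μs i) ∈ Icc (-(C * K)) (C * K) := by
      filter_upwards [hK] with i hi
      rw [mem_Icc, ← abs_le]
      have hw := integrable_weight (hi.trans_lt ENNReal.coe_lt_top)
      refine (norm_integral_le_of_norm_le (f := f) (hw.const_mul C) (.of_forall hC)).trans ?_
      rw [integral_const_mul]
      exact mul_le_mul_of_nonneg_left (integral_weight_le hi) hC0
    obtain ⟨a, -, ha⟩ := isCompact_Icc.ultrafilter_le_nhds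
      (U.map fun i => ∫ x, f x ∂(μs i)) (le_principal_iff.2 hb)
    exact ⟨a, ha⟩
  choose L hL using hex
  have hint (f : C_c(Space d, ℝ)) : ∀ᶠ i in (U : Filter ι), Integrable f (μs i) :=
    hK.mono fun i hi => integrable_compactlySupported (hi.trans_lt ENNReal.coe_lt_top) f
  let Λ : C_c(Space d, ℝ) →ₗ[ℝ] ℝ :=
    { toFun := L
      map_add' := fun f g => by
        refine tendsto_nhds_unique (hL (f + g)) (((hL f).add (hL g)).congr' ?_)
        filter_upwards [hint f, hint g] with i hf hg
        exact (integral_add hf hg).symm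
      map_smul' := fun c f => by
        refine tendsto_nhds_unique (hL (c • f)) (((hL f).const_mul c).congr' ?_)
        exact .of_forall fun i => (integral_const_mul c f).symm }
  let Λ' : C_c(Space d, ℝ) →ₚ[ℝ] ℝ := PositiveLinearMap.mk₀ Λ fun f hf =>
    ge_of_tendsto (hL f) (.of_forall fun i => integral_nonneg fun x => hf x)
  refine ⟨RealRMK.rieszMeasure Λ', inferInstance, fun f => ?_⟩
  rw [RealRMK.integral_rieszMeasure]
  exact hL f

end PointProcess

/-! ### Pair measures of finite sets and their Fourier transforms -/

namespace PointProcess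

variable {d : ℕ}

/-- The measure `∑_{x, y ∈ F} δ_{y - x}` of the differences of a finite set. -/
noncomputable def pairMeasure (F : Finset (Space d)) : Measure (Space d) :=
  ∑ x ∈ F, ∑ y ∈ F, Measure.dirac (y - x)

instance (F : Finset (Space d)) : IsFiniteMeasure (pairMeasure F) := by
  unfold pairMeasure
  infer_instance

theorem pairMeasure_apply (F : Finset (Space d)) {A : Set (Space d)} (hA : MeasurableSet A) :
    pairMeasure F A = ∑ x ∈ F, ∑ y ∈ F, A.indicator 1 (y - x) := by
  simp only [pairMeasure, Measure.finsetSum_apply]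
  simp_rw [Measure.dirac_apply' _ hA]

theorem integral_pairMeasure (F : Finset (Space d)) (f : Space d → ℂ) :
    ∫ x, f x ∂(pairMeasure F) = ∑ x ∈ F, ∑ y ∈ F, f (y - x) := by
  have hi (a : Space d) : Integrable f (Measure.dirac a) := integrable_dirac (by simp)
  rw [pairMeasure, integral_finsetSum_measure]
  · refine Finset.sum_congr rfl fun x _ => ?_
    rw [integral_finsetSum_measure fun y _ => hi _]
    simp
  · exact fun x _ => integrable_finsetSum_measure.2 fun y _ => hi _

/-- The points of a configuration in the ball of radius `R`. -/
noncomputable def points (φ : Config d) (R : ℝ) : Finset (Space d) :=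
  (φ.finite_inter (ball 0 R) isBounded_ball).toFinset

theorem empiricalAutocorrelation_eq_smul (φ : Config d) (R : ℝ) :
    empiricalAutocorrelation φ R
      = (volume (ball (0 : Space d) R))⁻¹ • pairMeasure (points φ R) := by
  have hmem (x : Space d) : x ∈ points φ R ↔ x ∈ φ.carrier ∩ ball 0 R := Set.Finite.mem_toFinset _
  have : Fintype ↥(φ.carrier ∩ ball 0 R) := (φ.finite_inter (ball 0 R) isBounded_ball).fintype
  rw [empiricalAutocorrelation]
  congr 1
  ext A hA
  rw [Measure.sum_apply _ hA, pairMeasure_apply _ hA, tsum_fintype, Fintype.sum_prod_type]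
  simp_rw [Measure.dirac_apply' _ hA]
  rw [Finset.sum_subtype _ hmem]
  refine Finset.sum_congr rfl fun x _ => ?_
  rw [Finset.sum_subtype _ hmem]

theorem mul_le_sq_add_sq (a b : ℝ≥0∞) : a * b ≤ a ^ 2 + b ^ 2 := by
  rcases le_total a b with h | h
  · calc a * b ≤ b * b := by gcongr
      _ = b ^ 2 := (sq b).symm
      _ ≤ a ^ 2 + b ^ 2 := le_add_self
  · calc a * b ≤ a * a := by gcongr
      _ = a ^ 2 := (sq a).symm
      _ ≤ a ^ 2 + b ^ 2 := le_self_add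

/-- The number of points of `F` within distance `1` of `t`. -/
noncomputable def localCount (F : Finset (Space d)) (t : Space d) : ℝ≥0∞ :=
  ∑ x ∈ F, (ball x 1).indicator 1 t

theorem measurable_localCount (F : Finset (Space d)) : Measurable (localCount F) :=
  Finset.measurable_fun_sum _ fun _ _ => measurable_one.indicator measurableSet_ball

theorem lintegral_localCount_mul (F : Finset (Space d)) (z : Space d) :
    ∫⁻ t, localCount F t * localCount F (t + z)
      = ∑ x ∈ F, ∑ y ∈ F, volume (ball x 1 ∩ ball (y - z) 1) := by
  have h1 (t : Space d) : localCount F t * localCount F (t + z)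
      = ∑ x ∈ F, ∑ y ∈ F, (ball x 1 ∩ ball (y - z) 1).indicator 1 t := by
    rw [localCount, localCount, Finset.sum_mul_sum]
    refine Finset.sum_congr rfl fun x _ => Finset.sum_congr rfl fun y _ => ?_
    have h2 : (ball y 1).indicator (1 : Space d → ℝ≥0∞) (t + z)
        = (ball (y - z) 1).indicator 1 t := by
      have : t + z ∈ ball y 1 ↔ t ∈ ball (y - z) 1 := by
        rw [mem_ball_iff_norm, mem_ball_iff_norm, sub_sub_eq_add_sub]
      by_cases h : t ∈ ball (y - z) 1 <;> simp [h, this]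
    rw [h2, inter_indicator_one]
    rfl
  have hm (x y : Space d) : Measurable fun t : Space d =>
      (ball x 1 ∩ ball (y - z) 1).indicator (1 : Space d → ℝ≥0∞) t :=
    measurable_one.indicator (measurableSet_ball.inter measurableSet_ball)
  simp_rw [h1]
  rw [lintegral_finsetSum _ fun x _ => Finset.measurable_fun_sum _ fun y _ => hm x y]
  refine Finset.sum_congr rfl fun x _ => ?_
  rw [lintegral_finsetSum _ fun y _ => hm x y]
  refine Finset.sum_congr rfl fun y _ => ?_
  exact lintegral_indicator_one (measurableSet_ball.inter measurableSet_ball)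

/-- Positive definiteness bounds the mass that a pair measure gives to an arbitrary unit ball by
the mass near the origin. -/
theorem volume_mul_pairMeasure_ball_le (F : Finset (Space d)) (z : Space d) :
    volume (ball (0 : Space d) (1 / 2)) * pairMeasure F (ball z 1)
      ≤ 2 * (volume (ball (0 : Space d) 1) * pairMeasure F (ball 0 2)) := by
  have hlow : volume (ball (0 : Space d) (1 / 2)) * pairMeasure F (ball z 1)
      ≤ ∫⁻ t, localCount F t * localCount F (t + z) := by
    rw [lintegral_localCount_mul, pairMeasure_apply F measurableSet_ball, Finset.mul_sum]
    refine Finset.sum_le_sum fun x _ => ?_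
    rw [Finset.mul_sum]
    refine Finset.sum_le_sum fun y _ => ?_
    by_cases h : y - x ∈ ball z 1
    · rw [indicator_of_mem h, Pi.one_apply, mul_one,
        ← Measure.addHaar_ball_center volume (midpoint ℝ x (y - z))]
      have hd : dist x (y - z) < 1 := by
        rw [mem_ball_iff_norm] at h
        rw [dist_comm, dist_eq_norm, sub_right_comm]
        exact h
      -- The ball of radius `1 / 2` around the midpoint of the centres lies in both unit balls.
      refine measure_mono (subset_inter (ball_subset_ball' ?_) (ball_subset_ball' ?_))
      · rw [dist_midpoint_left, Real.norm_two]
        linarith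
      · rw [dist_midpoint_right, Real.norm_two]
        linarith
    · simp [h]
  have hself : ∫⁻ t, localCount F t ^ 2
      ≤ volume (ball (0 : Space d) 1) * pairMeasure F (ball 0 2) := by
    have h1 := lintegral_localCount_mul F 0
    simp only [add_zero, sub_zero, ← sq] at h1
    rw [h1, pairMeasure_apply F measurableSet_ball, Finset.mul_sum]
    refine Finset.sum_le_sum fun x _ => ?_
    rw [Finset.mul_sum]
    refine Finset.sum_le_sum fun y _ => ?_
    by_cases h : y - x ∈ ball (0 : Space d) 2
    · rw [indicator_of_mem h, Pi.one_apply, mul_one, ← Measure.addHaar_ball_center volume x]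
      exact measure_mono inter_subset_left
    · have hempty : ball x 1 ∩ ball y 1 = ∅ := by
        refine eq_empty_of_forall_notMem fun t ht => h ?_
        have h1 := mem_ball.1 ht.1
        have h2 := mem_ball.1 ht.2
        rw [mem_ball_zero_iff, ← dist_eq_norm]
        linarith [dist_triangle_left y x t]
      simp [hempty]
  have hshift : ∫⁻ t, localCount F (t + z) ^ 2 = ∫⁻ t, localCount F t ^ 2 :=
    lintegral_add_right_eq_self (fun t => localCount F t ^ 2) z
  calc volume (ball (0 : Space d) (1 / 2)) * pairMeasure F (ball z 1)
      ≤ ∫⁻ t, localCount F t * localCount F (t + z) := hlow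
    _ ≤ ∫⁻ t, (localCount F t ^ 2 + localCount F (t + z) ^ 2) :=
        lintegral_mono fun t => mul_le_sq_add_sq _ _
    _ = 2 * ∫⁻ t, localCount F t ^ 2 := by
        rw [lintegral_add_left ((measurable_localCount F).pow_const 2), hshift, two_mul]
    _ ≤ _ := by gcongr

/-- The exponential sum `∑_{x ∈ F} e^{2πi⟨x, ξ⟩}`. -/
noncomputable def expSum (F : Finset (Space d)) (ξ : Space d) : ℂ := ∑ x ∈ F, (𝐞 ⟪x, ξ⟫ : ℂ)

theorem continuous_expSum (F : Finset (Space d)) : Continuous (expSum F) := by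
  unfold expSum
  refine continuous_finsetSum _ fun x _ => ?_
  exact continuous_subtype_val.comp
    (Real.continuous_fourierChar.comp (continuous_const.inner continuous_id))

/-- The measure with density `|∑_{x ∈ F} e^{2πi⟨x, ξ⟩}|²`, the Fourier transform of the pair
measure of `F`. -/
noncomputable def spectralMeasure (F : Finset (Space d)) : Measure (Space d) :=
  volume.withDensity fun ξ => ENNReal.ofReal (‖expSum F ξ‖ ^ 2)

instance (F : Finset (Space d)) : IsLocallyFiniteMeasure (spectralMeasure F) :=
  IsLocallyFiniteMeasure.withDensity_ofReal ((continuous_expSum F).norm.pow 2)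

theorem integral_spectralMeasure (F : Finset (Space d)) (g : Space d → ℂ) :
    ∫ ξ, g ξ ∂(spectralMeasure F) = ∫ ξ, ((‖expSum F ξ‖ ^ 2 : ℝ) : ℂ) * g ξ := by
  have hm : Measurable fun ξ : Space d => ENNReal.ofReal (‖expSum F ξ‖ ^ 2) :=
    ((continuous_expSum F).norm.pow 2).measurable.ennreal_ofReal
  rw [spectralMeasure, integral_withDensity_eq_integral_toReal_smul hm (by simp)]
  refine integral_congr_ae (.of_forall fun ξ => ?_)
  simp only [ENNReal.toReal_ofReal (sq_nonneg ‖expSum F ξ‖), Complex.real_smul]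

theorem norm_sq_expSum (F : Finset (Space d)) (ξ : Space d) :
    ((‖expSum F ξ‖ ^ 2 : ℝ) : ℂ) = ∑ x ∈ F, ∑ y ∈ F, (𝐞 (-⟪ξ, y - x⟫) : ℂ) := by
  have h1 : ((‖expSum F ξ‖ ^ 2 : ℝ) : ℂ) = expSum F ξ * (starRingEnd ℂ) (expSum F ξ) := by
    rw [Complex.mul_conj, Complex.normSq_eq_norm_sq]
  rw [h1, expSum, map_sum, Finset.sum_mul_sum]
  refine Finset.sum_congr rfl fun x _ => Finset.sum_congr rfl fun y _ => ?_
  rw [← Circle.coe_inv_eq_conj, ← AddChar.map_neg_eq_inv, ← Circle.coe_mul,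
    ← AddChar.map_add_eq_mul]
  congr 2
  rw [inner_sub_right, real_inner_comm x ξ, real_inner_comm y ξ]
  ring

/-- The pair measure and the spectral measure of a finite set are Fourier dual. -/
theorem integral_fourier_pairMeasure (F : Finset (Space d)) {g : Space d → ℂ}
    (hg : Integrable g) :
    ∫ x, 𝓕 g x ∂(pairMeasure F) = ∫ ξ, g ξ ∂(spectralMeasure F) := by
  have hi (x y : Space d) : Integrable fun ξ : Space d => (𝐞 (-⟪ξ, y - x⟫) : ℂ) * g ξ := by
    have := (Real.fourierIntegral_convergent_iff (y - x)).2 hg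
    exact this
  rw [integral_pairMeasure, integral_spectralMeasure]
  simp_rw [norm_sq_expSum, Finset.sum_mul]
  rw [integral_finsetSum _ fun x _ => integrable_finsetSum _ fun y _ => hi x y]
  refine Finset.sum_congr rfl fun x _ => ?_
  rw [integral_finsetSum _ fun y _ => hi x y]
  refine Finset.sum_congr rfl fun y _ => ?_
  rw [Real.fourier_eq]
  rfl

/-- A translation changes the Fourier transform only by a phase. -/
theorem norm_fourier_comp_sub (g : Space d → ℂ) (z x : Space d) :
    ‖𝓕 (fun ξ => g (ξ - z)) x‖ = ‖𝓕 g x‖ := by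
  have h := congrFun (VectorFourier.fourierIntegral_comp_add_right 𝐞 volume
    (innerₗ (Space d)) g (-z)) x
  simp only [← sub_eq_add_neg] at h
  change ‖VectorFourier.fourierIntegral 𝐞 volume (innerₗ (Space d)) (g ∘ fun v => v - z) x‖ = _
  rw [h, Circle.norm_smul]
  rfl

theorem exists_decay (g : 𝓢(Space d, ℂ)) :
    ∃ C : ℝ, 0 ≤ C ∧ ∀ x, ‖g x‖ ≤ C * (weight x / (1 + ‖x‖)) := by
  refine ⟨2 ^ (d + 2) * ((Finset.Iic (d + 2, 0)).sup
    fun m => SchwartzMap.seminorm ℂ m.1 m.2) g, by positivity, fun x => ?_⟩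
  have h := SchwartzMap.one_add_le_sup_seminorm_apply (𝕜 := ℂ) (m := (d + 2, 0)) (k := d + 2)
    (n := 0) le_rfl le_rfl g x
  rw [norm_iteratedFDeriv_zero] at h
  have hpos : 0 < 1 + ‖x‖ := by positivity
  rw [weight, Real.rpow_neg hpos.le, Real.rpow_natCast, ← one_div, div_div, mul_one_div,
    ← pow_succ, le_div_iff₀ (by positivity), mul_comm]
  exact h

theorem exists_le_weight (g : 𝓢(Space d, ℂ)) :
    ∃ C : ℝ≥0, ∀ x, ‖g x‖ ≤ C * weight x := by
  obtain ⟨C, hC0, hC⟩ := exists_decay g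
  refine ⟨⟨C, hC0⟩, fun x => (hC x).trans (mul_le_mul_of_nonneg_left ?_ hC0)⟩
  exact div_le_self (weight_pos x).le (by linarith [norm_nonneg x])

/-- The spectral measures are translation bounded in terms of the weighted mass of the pair
measures: test against the translates of a fixed bump function. -/
theorem exists_spectralMeasure_ball_le (d : ℕ) : ∃ C : ℝ≥0, ∀ (F : Finset (Space d)) (c : ℝ≥0∞)
    (K : ℝ≥0), c ≠ ∞ → weightMass (c • pairMeasure F) ≤ K →
    ∀ z, (c • spectralMeasure F) (ball z 1) ≤ ((C * K : ℝ≥0) : ℝ≥0∞) := by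
  let b : ContDiffBump (0 : Space d) := ⟨1, 2, one_pos, one_lt_two⟩
  have hbs : HasCompactSupport fun x : Space d => (b x : ℂ) :=
    b.hasCompactSupport.comp_left (g := fun r : ℝ => (r : ℂ)) rfl
  have hbc : ContDiff ℝ (⊤ : ℕ∞) fun x : Space d => (b x : ℂ) :=
    Complex.ofRealCLM.contDiff.comp b.contDiff
  let g : 𝓢(Space d, ℂ) := hbs.toSchwartzMap hbc
  obtain ⟨C, hC⟩ := exists_le_weight (𝓕 g)
  refine ⟨C, fun F c K hc hK z => ?_⟩
  have hcont : Continuous fun x : Space d => b (x - z) :=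
    b.continuous.comp (continuous_id.sub continuous_const)
  have hcs : HasCompactSupport fun x : Space d => b (x - z) :=
    b.hasCompactSupport.comp_homeomorph (Homeomorph.subRight z)
  have hint : Integrable (fun x : Space d => b (x - z)) (c • spectralMeasure F) :=
    (hcont.integrable_of_hasCompactSupport hcs).smul_measure hc
  have hgz : Integrable (fun x : Space d => (b (x - z) : ℂ)) :=
    (hcont.integrable_of_hasCompactSupport hcs).ofReal
  have hval : ((∫ x, b (x - z) ∂(c • spectralMeasure F) : ℝ) : ℂ)
      = ∫ x, 𝓕 (fun x : Space d => (b (x - z) : ℂ)) x ∂(c • pairMeasure F) := by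
    rw [← integral_complex_ofReal, integral_smul_measure, integral_smul_measure,
      integral_fourier_pairMeasure F hgz]
  have hle : ∫ x, b (x - z) ∂(c • spectralMeasure F) ≤ C * K := by
    have h0 : 0 ≤ ∫ x, b (x - z) ∂(c • spectralMeasure F) :=
      integral_nonneg fun x => b.nonneg
    rw [← Real.norm_of_nonneg h0, ← Complex.norm_real, hval]
    have hw := integrable_weight (hK.trans_lt ENNReal.coe_lt_top)
    refine (norm_integral_le_of_norm_le (hw.const_mul (C : ℝ)) (.of_forall fun x => ?_)).trans ?_
    · exact (norm_fourier_comp_sub (fun x => (b x : ℂ)) z x).trans_le (hC x)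
    · rw [integral_const_mul]
      exact mul_le_mul_of_nonneg_left (integral_weight_le hK) C.2
  calc (c • spectralMeasure F) (ball z 1)
      = ∫⁻ x, (ball z 1).indicator 1 x ∂(c • spectralMeasure F) :=
        (lintegral_indicator_one measurableSet_ball).symm
    _ ≤ ∫⁻ x, ENNReal.ofReal (b (x - z)) ∂(c • spectralMeasure F) := by
        refine lintegral_mono fun x => ?_
        by_cases hx : x ∈ ball z 1
        · have h1 : x - z ∈ closedBall (0 : Space d) b.rIn := by
            rw [mem_closedBall_zero_iff, ← dist_eq_norm]
            exact (mem_ball.1 hx).le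
          simp [hx, b.one_of_mem_closedBall h1]
        · simp [hx]
    _ = ENNReal.ofReal (∫ x, b (x - z) ∂(c • spectralMeasure F)) :=
        (ofReal_integral_eq_lintegral_ofReal hint (.of_forall fun x => b.nonneg)).symm
    _ ≤ ENNReal.ofReal (C * K) := ENNReal.ofReal_le_ofReal hle
    _ = ((C * K : ℝ≥0) : ℝ≥0∞) := by
        rw [← NNReal.coe_mul, ENNReal.ofReal_coe_nnreal]

end PointProcess

/-! ### The diffraction measure -/

namespace PointProcess

variable {d : ℕ}

theorem inv_volume_ball_ne_top {R : ℝ} (hR : 0 < R) : (volume (ball (0 : Space d) R))⁻¹ ≠ ∞ :=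
  ENNReal.inv_ne_top.2 (measure_ball_pos _ _ hR).ne'

theorem IsAutocorrelation.exists_eventually_ball_le {φ : Config d} {γ : Measure (Space d)}
    (h : IsAutocorrelation φ γ) (r : ℝ) :
    ∃ K : ℝ≥0, ∀ᶠ R in atTop, empiricalAutocorrelation φ R (ball 0 r) ≤ K := by
  obtain ⟨χ, h01, h1⟩ := exists_cutoff (0 : Space d) r
  refine ⟨Real.toNNReal ((∫ x, χ x ∂γ) + 1), ?_⟩
  filter_upwards [(h.2 χ).eventually (gt_mem_nhds (lt_add_one _)), eventually_gt_atTop 0]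
    with R hR hR0
  have hfin : IsFiniteMeasure (empiricalAutocorrelation φ R) := by
    rw [empiricalAutocorrelation_eq_smul]
    exact Measure.smul_finite _ (inv_volume_ball_ne_top hR0)
  calc empiricalAutocorrelation φ R (ball 0 r)
      = ∫⁻ x, (ball 0 r).indicator 1 x ∂(empiricalAutocorrelation φ R) :=
        (lintegral_indicator_one measurableSet_ball).symm
    _ ≤ ∫⁻ x, ENNReal.ofReal (χ x) ∂(empiricalAutocorrelation φ R) := by
        refine lintegral_mono fun x => ?_
        by_cases hx : x ∈ ball 0 r
        · simp [hx, h1 x (ball_subset_closedBall hx)]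
        · simp [hx]
    _ = ENNReal.ofReal (∫ x, χ x ∂(empiricalAutocorrelation φ R)) :=
        (ofReal_integral_eq_lintegral_ofReal χ.integrable (.of_forall fun x => (h01 x).1)).symm
    _ ≤ ENNReal.ofReal ((∫ x, χ x ∂γ) + 1) := ENNReal.ofReal_le_ofReal hR.le
    _ = _ := rfl

theorem IsAutocorrelation.exists_eventually_weightMass_le {φ : Config d} {γ : Measure (Space d)}
    (h : IsAutocorrelation φ γ) :
    ∃ K : ℝ≥0, ∀ᶠ R in atTop, weightMass (empiricalAutocorrelation φ R) ≤ K := by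
  obtain ⟨M, hM⟩ := h.exists_eventually_ball_le 2
  obtain ⟨C, hC⟩ := exists_weightMass_le d
  set v := volume (ball (0 : Space d) (1 / 2)) with hv
  have hv0 : v ≠ 0 := (measure_ball_pos _ _ (by norm_num)).ne'
  have hvt : v ≠ ∞ := measure_ball_lt_top.ne
  have hB : 2 * (volume (ball (0 : Space d) 1) * M) / v ≠ ∞ :=
    ENNReal.div_ne_top (ENNReal.mul_ne_top (by finiteness)
      (ENNReal.mul_ne_top measure_ball_lt_top.ne ENNReal.coe_ne_top)) hv0
  refine ⟨C * (2 * (volume (ball (0 : Space d) 1) * M) / v).toNNReal, ?_⟩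
  filter_upwards [hM] with R hR
  have hsf : SFinite (empiricalAutocorrelation φ R) := by
    rw [empiricalAutocorrelation_eq_smul]
    infer_instance
  refine hC _ _ fun z => ?_
  rw [ENNReal.coe_toNNReal hB, ENNReal.le_div_iff_mul_le (Or.inl hv0) (Or.inl hvt)]
  refine le_trans ?_ (mul_le_mul_right (mul_le_mul_right hR _) _)
  rw [empiricalAutocorrelation_eq_smul, Measure.smul_apply, Measure.smul_apply, smul_eq_mul,
    smul_eq_mul]
  calc _ = (volume (ball (0 : Space d) R))⁻¹ * (v * pairMeasure (points φ R) (ball z 1)) := by ring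
    _ ≤ (volume (ball (0 : Space d) R))⁻¹ *
        (2 * (volume (ball (0 : Space d) 1) * pairMeasure (points φ R) (ball 0 2))) :=
        mul_le_mul_right (volume_mul_pairMeasure_ball_le _ z) _
    _ = _ := by ring

/-- Every autocorrelation of a configuration is a tempered measure, and its Fourier transform is
a tempered measure: a vague limit of the spectral measures of the finite pieces. -/
theorem IsAutocorrelation.exists_isDiffractionMeasure {φ : Config d} {γ : Measure (Space d)}
    (h : IsAutocorrelation φ γ) :
    ∃ m : Measure (Space d), ∃ (_ : γ.HasTemperateGrowth) (_ : m.HasTemperateGrowth),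
      𝓕 γ.toTemperedDistribution = m.toTemperedDistribution := by
  have hlf : IsLocallyFiniteMeasure γ := h.1
  obtain ⟨K, hK⟩ := h.exists_eventually_weightMass_le
  have hγ : weightMass γ ≤ K := weightMass_le_of_tendsto hK h.2
  obtain ⟨C, hC⟩ := exists_weightMass_le d
  obtain ⟨C', hC'⟩ := exists_spectralMeasure_ball_le d
  set σ : ℝ → Measure (Space d) := fun R =>
    (volume (ball (0 : Space d) R))⁻¹ • spectralMeasure (points φ R) with hσ
  have hσK : ∀ᶠ R in atTop, weightMass (σ R) ≤ ((C * (C' * K) : ℝ≥0) : ℝ≥0∞) := by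
    filter_upwards [hK, eventually_gt_atTop 0] with R hR hR0
    have hsf : SFinite (σ R) := by
      have : SFinite (spectralMeasure (points φ R)) := inferInstance
      exact inferInstance
    rw [empiricalAutocorrelation_eq_smul] at hR
    exact hC _ _ (hC' _ _ _ (inv_volume_ball_ne_top hR0) hR)
  let U : Ultrafilter ℝ := Ultrafilter.of atTop
  have hU : (U : Filter ℝ) ≤ atTop := Ultrafilter.of_le _
  have hσU := hσK.filter_mono hU
  obtain ⟨m, hm, hlim⟩ := exists_tendsto_of_weightMass_le U hσU
  have hmK := weightMass_le_of_tendsto hσU hlim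
  have hγT := hasTemperateGrowth_of_weightMass (hγ.trans_lt ENNReal.coe_lt_top)
  have hmT := hasTemperateGrowth_of_weightMass (hmK.trans_lt ENNReal.coe_lt_top)
  refine ⟨m, hγT, hmT, ?_⟩
  ext g
  change ∫ x, 𝓕 g x ∂γ = ∫ x, g x ∂m
  obtain ⟨D, _, hD⟩ := exists_decay g
  obtain ⟨D', _, hD'⟩ := exists_decay (𝓕 g)
  have h1 := (tendsto_integral_of_decay hK hγ h.2 (𝓕 g).continuous hD').mono_left hU
  have h2 := tendsto_integral_of_decay hσU hmK hlim g.continuous hD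
  refine tendsto_nhds_unique h1 (h2.congr fun R => ?_)
  rw [hσ, empiricalAutocorrelation_eq_smul, integral_smul_measure, integral_smul_measure,
    ← integral_fourier_pairMeasure _ g.integrable, SchwartzMap.fourier_coe]

theorem lintegral_sq_lt_top_of_squareIntegrable {Ω : Type*} [MeasurableSpace Ω] {P : Measure Ω}
    {χ : Ω → Config d} (hχ : Measurable χ) (hsq : SquareIntegrable P χ) (r : ℝ) :
    ∫⁻ φ, (N (closedBall 0 r) φ : ℝ≥0∞) ^ 2 ∂(P.map χ) < ∞ := by
  have hm : Measurable fun φ : Config d => (N (closedBall 0 r) φ : ℝ≥0∞) ^ 2 :=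
    ((measurable_from_top (f := fun k : ℕ => (k : ℝ≥0∞))).comp
      (measurable_N isBounded_closedBall measurableSet_closedBall)).pow_const 2
  rw [lintegral_map hm hχ]
  have h := lintegral_rpow_enorm_lt_top_of_eLpNorm_lt_top two_ne_zero ENNReal.ofNat_ne_top
    (hsq _ (isCompact_closedBall 0 r)).2
  simpa using h

end PointProcess

end

theorem theorem1 {d : ℕ} {Ω : Type*} [MeasurableSpace Ω] (P : Measure Ω) [IsProbabilityMeasure P]
    (χ : Ω → PointProcess.Config d) (hχ : Measurable χ)
    (hstat : PointProcess.Stationary (P.map χ))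
    (herg : PointProcess.Ergodic (P.map χ))
    (hsq : PointProcess.SquareIntegrable P χ)
    (B : Set (PointProcess.Space d)) (hB : MeasurableSet B)
    (hB0 : 0 < volume B) (hBfin : volume B < ∞) :
    IsLocallyFiniteMeasure (PointProcess.intensity (PointProcess.palm (P.map χ) B hB)) ∧
    (∀ C : Set (PointProcess.Space d), Bornology.IsBounded C → MeasurableSet C →
      ∀ᵐ ω ∂P, Tendsto (fun R : ℝ => PointProcess.empiricalAutocorrelation (χ ω) R C) atTop
        (𝓝 (PointProcess.intensity (PointProcess.palm (P.map χ) B hB) C))) ∧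
    (∀ᵐ ω ∂P, PointProcess.IsAutocorrelation (χ ω)
      (PointProcess.intensity (PointProcess.palm (P.map χ) B hB))) ∧
    (∃ m : Measure (PointProcess.Space d),
      ∀ᵐ ω ∂P, PointProcess.IsDiffractionMeasure (χ ω) m) := by
  have hprob : IsProbabilityMeasure (P.map χ) := Measure.isProbabilityMeasure_map hχ.aemeasurable
  have hsq' := PointProcess.lintegral_sq_lt_top_of_squareIntegrable hχ hsq
  have hauto : ∀ᵐ ω ∂P, PointProcess.IsAutocorrelation (χ ω)
      (PointProcess.intensity (PointProcess.palm (P.map χ) B hB)) :=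
    ae_of_ae_map hχ.aemeasurable
      (PointProcess.ae_isAutocorrelation hstat herg hsq' hB hB0 hBfin)
  refine ⟨PointProcess.isLocallyFiniteMeasure_intensity_palm hstat hsq' hB hB0 hBfin,
    fun C hb hC => ae_of_ae_map hχ.aemeasurable
      (PointProcess.ae_tendsto_empiricalAutocorrelation hstat herg hsq' hB hB0 hBfin hb hC),
    hauto, ?_⟩
  -- The limit does not depend on `ω`, so one typical realisation determines its transform.
  obtain ⟨ω, hω⟩ := hauto.exists
  obtain ⟨m, hγT, hmT, hm⟩ := hω.exists_isDiffractionMeasure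
  exact ⟨m, hauto.mono fun ω' hω' => ⟨_, hω', hγT, hmT, hm⟩⟩
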